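/- Let $\mathcal H$ be an infinite-dimensional complex Hilbert space (not necessarily separable) and let $\mathbf A=(A_1,\dots,A_m)$ be an $m$-tuple of compact operators on $\mathcal H$. For a tuple $\mathbf B=(B_1,\dots,B_m)$ of bounded operators on a complex Hilbert space and a positive integer $k$, put $$W_k(\mathbf B)=\Big\{\Big(\sum_{\ell=1}^k\langle B_1x_\ell,x_\ell\rangle,\dots,\sum_{\ell=1}^k\langle B_mx_\ell,x_\ell\rangle\Big): x_1,\dots,x_k \text{ orthonormal}\Big\}\subseteq\mathbb C^m ,$$ and let $\Sigma_k(\mathbf B)$ be the set of all sums $\mu_1+\dots+\mu_k$ where $\mu_1,\dots,\mu_k\in\mathbb C^m$ are joint eigenvalues of $\mathbf B$ corresponding to $k$ linearly independent common eigenvectors $x_1,\dots,x_k$, that is, $B_jx_\ell=(\mu_\ell)_j\,x_\ell$ for all $j$ and $\ell$. Let $\mathbf A\oplus\mathbf 0_k=(A_1\oplus 0_k,\dots,A_m\oplus 0_k)$, where $0_k$ is the zero operator on $\mathbb C^k$, and let $\mathbf A\oplus\mathbf 0_\infty=(A_1\oplus 0_\infty,\dots,A_m\oplus 0_\infty)$,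 where $0_\infty$ is the zero operator on an arbitrary fixed infinite-dimensional complex Hilbert space. A subset of $\mathbb C^m\cong\mathbb R^{2m}$ is called polyhedral if it is the (real) convex hull of a finite set. Write $\mathrm{cl}$ for closure and $\mathrm{conv}$ for the (real) convex hull. Then for every integer $k\ge 1$, $$\mathrm{cl}\,W_k(\mathbf A)=W_k(\mathbf A\oplus\mathbf 0_k)=W_k(\mathbf A\oplus\mathbf 0_\infty)$$ and $$\mathrm{cl}\,(\mathrm{conv}\,W_k(\mathbf A))=\mathrm{conv}\,W_k(\mathbf A\oplus\mathbf 0_k)=\mathrm{conv}\,W_k(\mathbf A\oplus\mathbf 0_\infty).$$ Moreover, the following conditions are equivalent: (a) $\mathrm{cl}\,W_k(\mathbf A)$ is polyhedral for every integer $k\ge 1$; (b) $\mathrm{cl}\,(\mathrm{conv}\,W_k(\mathbf A))$ is polyhedral for every integer $k\ge 1$; (c) $A_1,\dots,A_m$ are normal and commute pairwise, and $\mathrm{conv}\,\Sigma_k(\mathbf A\oplus\mathbf 0_\infty)$ is polyhedral for every integer $k\ge 1$. -/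

import Mathlib

/-- The joint `k`-numerical range `W_k(A₁, …, A_m)`: all vectors
`(∑ ℓ, ⟨A₁ x_ℓ, x_ℓ⟩, …, ∑ ℓ, ⟨A_m x_ℓ, x_ℓ⟩)` with `x₁, …, x_k` orthonormal.
(Mathlib's `inner ℂ x y` is linear in `y`, so `inner ℂ x (A x)` is the usual `⟨A x, x⟩`.) -/
def jointNumericalRange {H : Type*} [NormedAddCommGroup H] [InnerProductSpace ℂ H] {m : ℕ}
    (k : ℕ) (A : Fin m → H →L[ℂ] H) : Set (Fin m → ℂ) :=
  {a | ∃ x : Fin k → H, Orthonormal ℂ x ∧ ∀ j, a j = ∑ l, inner ℂ (x l) (A j (x l))}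

/-- `x` is a common eigenvector of `A₁, …, A_m` for the joint eigenvalue `μ ∈ ℂ^m`. -/
def IsJointEigenvector {H : Type*} [NormedAddCommGroup H] [InnerProductSpace ℂ H] {m : ℕ}
    (A : Fin m → H →L[ℂ] H) (μ : Fin m → ℂ) (x : H) : Prop :=
  x ≠ 0 ∧ ∀ j, A j x = μ j • x

/-- `Σ_k(A)`: all sums `μ₁ + ⋯ + μ_k` of joint eigenvalues of `A` corresponding to `k` linearly
independent common eigenvectors. -/
def jointEigenvalueSums {H : Type*} [NormedAddCommGroup H] [InnerProductSpace ℂ H] {m : ℕ}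
    (k : ℕ) (A : Fin m → H →L[ℂ] H) : Set (Fin m → ℂ) :=
  {a | ∃ (μ : Fin k → Fin m → ℂ) (x : Fin k → H), LinearIndependent ℂ x ∧
    (∀ l, IsJointEigenvector A (μ l) (x l)) ∧ a = ∑ l, μ l}

/-- The operator `S ⊕ 0` on the orthogonal direct sum of Hilbert spaces `H ⊕ K`. -/
noncomputable def oplusZero {H : Type*} [NormedAddCommGroup H] [InnerProductSpace ℂ H]
    (K : Type*) [NormedAddCommGroup K] [InnerProductSpace ℂ K] (S : H →L[ℂ] H) :
    WithLp 2 (H × K) →L[ℂ] WithLp 2 (H × K) :=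
  ((WithLp.prodContinuousLinearEquiv 2 ℂ H K).symm : H × K →L[ℂ] WithLp 2 (H × K)) ∘L
    (S.prodMap (0 : K →L[ℂ] K)) ∘L
    (WithLp.prodContinuousLinearEquiv 2 ℂ H K : WithLp 2 (H × K) →L[ℂ] H × K)

theorem oplusZero_apply {H : Type*} [NormedAddCommGroup H] [InnerProductSpace ℂ H]
    (K : Type*) [NormedAddCommGroup K] [InnerProductSpace ℂ K] (S : H →L[ℂ] H)
    (x : H) (y : K) :
    oplusZero K S (WithLp.toLp 2 (x, y)) = WithLp.toLp 2 (S x, 0) := rfl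

/-- A set in `ℂ^m` is polyhedral if it is the (real) convex hull of a finite set. -/
def IsPolyhedral {m : ℕ} (S : Set (Fin m → ℂ)) : Prop :=
  ∃ F : Set (Fin m → ℂ), F.Finite ∧ S = convexHull ℝ F

/-! Everything passes through contractive families, the images of the standard basis of `ℂ^k` under
contractions. First components of an orthonormal family in `H ⊕ F` are contractive; conversely a
contractive family is completed to an orthonormal one by vectors of `F` whose Gram matrix is the
defect `1 - gram u` (`jointNumericalRange_oplusZero`). So `contractiveRange k A` is the range of `A
⊕ 0` as soon as `F` contains `k` orthonormal vectors. It is compact, since compact operators turn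
weak limits into limits of forms, and it lies in `cl W_k(A)`, since the completing vectors can be
taken in `H` itself, far out where all `A j` are small. Both chains of equalities follow.

For (b) ⇒ (c), take a real functional `f` injective on each finite set generating a polytope, and
choose orthonormal vectors greedily, each maximizing `f` of the form on the complement of the
earlier ones. A Ky Fan inequality makes the resulting sum maximal for `f` over the range, so it is a
vertex and the range is conical there. Rotating the last vector then gives zero first variation,
which makes it a common eigenvector of all `A j` and their adjoints, a reducing vector. If `f` were
positive at some vector orthogonal to all reducing vectors, the procedure would never stop and would
contradict compactness. Density of such `f` and polarization show that the reducing vectors are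
total, hence normality and commutation.

For commuting normal operators the same greedy choice, now with common eigenvectors of a
finite-dimensional top eigenspace and kernel vectors as padding, shows that every `f` attains its
maximum over the range of `A ⊕ 0` on `Σ_k` (`exists_jointEigenvalueSums_max`). The Schur–Horn
theorem for projections places `conv Σ_k` inside that range
(`convexHull_jointEigenvalueSums_subset`). Hahn–Banach separation then identifies the two sets once
either hull is a polytope. -/

open Filter Topology

/-- The vector `(⟨A₁ x, x⟩, …, ⟨A_m x, x⟩)`. -/
noncomputable def jointForm {H : Type*} [NormedAddCommGroup H] [InnerProductSpace ℂ H] {m : ℕ}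
    (A : Fin m → H →L[ℂ] H) (x : H) : Fin m → ℂ := fun j => inner ℂ x (A j x)

theorem conj_mul_self_eq_ofReal (c : ℂ) : (starRingEnd ℂ) c * c = ((‖c‖ ^ 2 : ℝ) : ℂ) := by
  rw [mul_comm, Complex.mul_conj, Complex.normSq_eq_norm_sq]

/-! ### Weak limits along ultrafilters and compact operators. -/

section WeakCompactness

variable {E : Type*} [NormedAddCommGroup E] [InnerProductSpace ℂ E] {m : ℕ}

theorem jointForm_smul (A : Fin m → E →L[ℂ] E) (c : ℂ) (x : E) :
    jointForm A (c • x) = (‖c‖ ^ 2 : ℝ) • jointForm A x := by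
  funext j
  simp only [jointForm, map_smul, inner_smul_left, inner_smul_right, Pi.smul_apply,
    Complex.real_smul]
  rw [← conj_mul_self_eq_ofReal]; ring

theorem mem_jointNumericalRange_iff {k : ℕ} {A : Fin m → E →L[ℂ] E} {a : Fin m → ℂ} :
    a ∈ jointNumericalRange k A ↔
      ∃ x : Fin k → E, Orthonormal ℂ x ∧ a = ∑ l, jointForm A (x l) := by
  simp only [jointNumericalRange, Set.mem_ofPred_eq, funext_iff, Finset.sum_apply, jointForm]

/-- The image of a set `D` is compact if each ultrafilter on `D` has a limit in `D` along which
the map is continuous. -/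
theorem isCompact_image_of_ultrafilter {X Y : Type*} [TopologicalSpace Y] {D : Set X} {Φ : X → Y}
    (h : ∀ U : Ultrafilter X, D ∈ U → ∃ x ∈ D, Tendsto Φ U (𝓝 (Φ x))) : IsCompact (Φ '' D) := by
  rw [isCompact_iff_ultrafilter_le_nhds]
  intro V hV
  have hne : (comap Φ V ⊓ 𝓟 D).NeBot := by
    rw [← Filter.map_neBot_iff Φ, Filter.push_pull', Filter.map_principal]
    rw [inf_eq_left.mpr hV]
    infer_instance
  -- `V` lifts to an ultrafilter on `D` because it contains the image of `D`.
  obtain ⟨U, hU⟩ := Ultrafilter.exists_le (comap Φ V ⊓ 𝓟 D)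
  have hD : D ∈ U := le_principal_iff.mp (hU.trans inf_le_right)
  have hm : U.map Φ = V := Ultrafilter.coe_le_coe.mp (tendsto_iff_comap.mpr (hU.trans inf_le_left))
  obtain ⟨x, hx, hlim⟩ := h U hD
  refine ⟨Φ x, ⟨x, hx, rfl⟩, ?_⟩
  rw [← hm]
  exact hlim

/-- Weak limits do not increase norms. -/
theorem norm_le_of_weak {ι : Type*} {U : Ultrafilter ι} {u : ι → E} {r : ℝ}
    (hu : ∀ᶠ i in (U : Filter ι), ‖u i‖ ≤ r) {x : E}
    (hx : ∀ y, Tendsto (fun i => inner ℂ y (u i)) U (𝓝 (inner ℂ y x))) : ‖x‖ ≤ r := by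
  have h1 : ‖inner ℂ x x‖ ≤ ‖x‖ * r :=
    le_of_tendsto (hx x).norm <| by
      filter_upwards [hu] with i hi
      exact (norm_inner_le_norm _ _).trans (by gcongr)
  have h2 : ‖inner ℂ x x‖ = ‖x‖ * ‖x‖ := by
    rw [inner_self_eq_norm_sq_to_K, norm_pow, sq]; simp
  rw [h2] at h1
  rcases (norm_nonneg x).eq_or_lt with h | h
  · obtain ⟨i, hi⟩ := hu.exists
    rw [← h]; exact (norm_nonneg _).trans hi
  · exact le_of_mul_le_mul_left h1 h

variable [CompleteSpace E]

/-- Bounded families have weak limits along ultrafilters. -/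
theorem exists_weak_limit {ι : Type*} (U : Ultrafilter ι) (u : ι → E) {r : ℝ}
    (hu : ∀ᶠ i in (U : Filter ι), ‖u i‖ ≤ r) :
    ∃ x : E, ∀ y, Tendsto (fun i => inner ℂ y (u i)) U (𝓝 (inner ℂ y x)) := by
  -- Banach–Alaoglu in the dual; the Riesz representation brings the limit functional back to a
  -- vector.
  have hc := WeakDual.isCompact_closedBall (𝕜 := ℂ) (E := E) 0 r
  rw [isCompact_iff_ultrafilter_le_nhds] at hc
  let g : ι → WeakDual ℂ E := fun i => StrongDual.toWeakDual (InnerProductSpace.toDual ℂ E (u i))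
  obtain ⟨φ, -, hφ⟩ := hc (U.map g) (by
    rw [le_principal_iff]
    change g ⁻¹' _ ∈ (U : Filter ι)
    filter_upwards [hu] with i hi
    simpa [g] using hi)
  obtain ⟨x, hx⟩ := (InnerProductSpace.toDual ℂ E).surjective (WeakDual.toStrongDual φ)
  refine ⟨x, fun y => ?_⟩
  have h1 : Tendsto (fun i => g i y) U (𝓝 (φ y)) :=
    ((WeakDual.eval_continuous y).tendsto φ).comp (show Tendsto g U (𝓝 φ) from hφ)
  have h2 : φ y = inner ℂ x y := by
    rw [← InnerProductSpace.toDual_apply_apply (𝕜 := ℂ), hx]; rfl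
  have h3 : Tendsto (fun i => inner ℂ (u i) y) U (𝓝 (inner ℂ x y)) := by
    rw [← h2]; exact h1
  have h4 := (Complex.continuous_conj.tendsto _).comp h3
  simpa only [Function.comp_def, inner_conj_symm] using h4

/-- A compact operator maps bounded weakly convergent families to norm convergent ones. -/
theorem IsCompactOperator.tendsto_of_weak {ι : Type*} {U : Ultrafilter ι} {u : ι → E} {r : ℝ}
    {T : E →L[ℂ] E} (hT : IsCompactOperator T) (hu : ∀ᶠ i in (U : Filter ι), ‖u i‖ ≤ r) {x : E}
    (hx : ∀ y, Tendsto (fun i => inner ℂ y (u i)) U (𝓝 (inner ℂ y x))) :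
    Tendsto (fun i => T (u i)) U (𝓝 (T x)) := by
  -- Compactness supplies some norm limit `w`; pairing with `y` and moving `T` to its adjoint
  -- identifies `w` as `T x`.
  obtain ⟨C, hC, hsub⟩ := hT.image_closedBall_subset_compact (f := T.toLinearMap) r
  rw [isCompact_iff_ultrafilter_le_nhds] at hC
  obtain ⟨w, -, hw⟩ := hC (U.map fun i => T (u i)) (by
    rw [le_principal_iff]
    change (fun i => T (u i)) ⁻¹' C ∈ (U : Filter ι)
    filter_upwards [hu] with i hi
    exact hsub ⟨u i, by simpa using hi, rfl⟩)
  have hw : Tendsto (fun i => T (u i)) U (𝓝 w) := hw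
  suffices w = T x by rwa [← this]
  refine ext_inner_left ℂ fun y => ?_
  have h1 : Tendsto (fun i => inner ℂ y (T (u i))) U (𝓝 (inner ℂ y w)) :=
    tendsto_const_nhds.inner hw
  have h2 := hx (ContinuousLinearMap.adjoint T y)
  simp only [ContinuousLinearMap.adjoint_inner_left] at h2
  exact tendsto_nhds_unique h1 h2

/-- Write `⟨u i, A u i⟩ = ⟨u i, A u i - A x⟩ + ⟨u i, A x⟩`: the first term vanishes by norm
convergence of `A u i`, the second converges weakly. -/
theorem tendsto_jointForm_of_weak {ι : Type*} {U : Ultrafilter ι} {u : ι → E} {r : ℝ}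
    {A : Fin m → E →L[ℂ] E} (hA : ∀ j, IsCompactOperator (A j))
    (hu : ∀ᶠ i in (U : Filter ι), ‖u i‖ ≤ r) {x : E}
    (hx : ∀ y, Tendsto (fun i => inner ℂ y (u i)) U (𝓝 (inner ℂ y x))) :
    Tendsto (fun i => jointForm A (u i)) U (𝓝 (jointForm A x)) := by
  rw [tendsto_pi_nhds]
  intro j
  have h1 : Tendsto (fun i => A j (u i) - A j x) U (𝓝 0) := by
    simpa using ((hA j).tendsto_of_weak hu hx).sub_const (A j x)
  have h2 : Tendsto (fun i => inner ℂ (u i) (A j (u i) - A j x)) U (𝓝 0) := by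
    refine squeeze_zero_norm' (a := fun i => r * ‖A j (u i) - A j x‖) ?_ ?_
    · filter_upwards [hu] with i hi
      exact (norm_inner_le_norm _ _).trans (by gcongr)
    · simpa using h1.norm.const_mul r
  have h3 : Tendsto (fun i => inner ℂ (u i) (A j x)) U (𝓝 (inner ℂ x (A j x))) := by
    have h4 := (Complex.continuous_conj.tendsto _).comp (hx (A j x))
    simpa only [Function.comp_def, inner_conj_symm] using h4
  have h5 := h2.add h3
  simpa only [jointForm, inner_sub_right, sub_add_cancel, zero_add] using h5

/-- On the unit ball of an orthogonal complement, a real functional of the joint form of compact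
operators attains its maximum. -/
theorem exists_max_jointForm {A : Fin m → E →L[ℂ] E} (hA : ∀ j, IsCompactOperator (A j))
    (f : (Fin m → ℂ) →L[ℝ] ℝ) (S : Set E) :
    ∃ y : E, ‖y‖ ≤ 1 ∧ (∀ s ∈ S, inner ℂ s y = 0) ∧
      ∀ z : E, ‖z‖ ≤ 1 → (∀ s ∈ S, inner ℂ s z = 0) → f (jointForm A z) ≤ f (jointForm A y) := by
  let D : Set E := {y | ‖y‖ ≤ 1 ∧ ∀ s ∈ S, inner ℂ s y = 0}
  have hc : IsCompact ((fun y => f (jointForm A y)) '' D) := by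
    refine isCompact_image_of_ultrafilter fun U hU => ?_
    have hu : ∀ᶠ i in (U : Filter E), ‖i‖ ≤ 1 := mem_of_superset hU fun y hy => hy.1
    obtain ⟨x, hx⟩ := exists_weak_limit U id hu
    refine ⟨x, ⟨norm_le_of_weak (u := id) hu hx, fun s hs => ?_⟩,
      (f.continuous.tendsto _).comp (tendsto_jointForm_of_weak (u := id) hA hu hx)⟩
    refine tendsto_nhds_unique (hx s) (tendsto_const_nhds.congr' ?_)
    exact mem_of_superset hU fun y hy => (hy.2 s hs).symm
  obtain ⟨-, ⟨y, hy, rfl⟩, hmax⟩ := hc.exists_isGreatest ⟨_, 0, by simp [D], rfl⟩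
  exact ⟨y, hy.1, hy.2, fun z hz hz' => hmax ⟨z, ⟨hz, hz'⟩, rfl⟩⟩

/-- Compact operators are uniformly small off a finite-dimensional subspace. -/
theorem IsCompactOperator.exists_finiteDimensional_norm_le {T : E →L[ℂ] E}
    (hT : IsCompactOperator T) {ε : ℝ} (hε : 0 < ε) :
    ∃ M : Submodule ℂ E, FiniteDimensional ℂ M ∧ ∀ x ∈ Mᗮ, ‖T x‖ ≤ ε * ‖x‖ := by
  obtain ⟨C, hC, hsub⟩ := hT.image_closedBall_subset_compact (f := T.toLinearMap) 1
  obtain ⟨t, htf, ht⟩ := Metric.totallyBounded_iff.mp hC.totallyBounded ε hε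
  -- For `x ⊥ M`, `T x` is orthogonal to the whole net `t`; by Pythagoras its norm is at most its
  -- distance to the net.
  let M := Submodule.span ℂ (ContinuousLinearMap.adjoint T '' t)
  refine ⟨M, FiniteDimensional.span_of_finite ℂ (htf.image _), ?_⟩
  have key : ∀ x ∈ Mᗮ, ‖x‖ ≤ 1 → ‖T x‖ ≤ ε := by
    intro x hx hx1
    obtain ⟨y, hy, hd⟩ := Set.mem_iUnion₂.mp (ht (hsub ⟨x, by simpa using hx1, rfl⟩))
    have ho : inner ℂ y (T x) = 0 := by
      rw [← ContinuousLinearMap.adjoint_inner_left]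
      exact hx _ (Submodule.subset_span ⟨y, hy, rfl⟩)
    have hd : ‖T x - y‖ < ε := by simpa [dist_eq_norm] using hd
    have h1 : ‖T x - y‖ * ‖T x - y‖ = ‖T x‖ * ‖T x‖ + ‖y‖ * ‖y‖ :=
      by
      have h2 := norm_sub_mul_self (𝕜 := ℂ) (T x) y
      rw [inner_eq_zero_symm.mp ho] at h2
      simpa using h2
    nlinarith [norm_nonneg (T x), norm_nonneg y, norm_nonneg (T x - y)]
  intro x hx
  rcases eq_or_ne x 0 with rfl | h0
  · simp
  have hn : 0 < ‖x‖ := norm_pos_iff.mpr h0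
  have h1 := key (((‖x‖⁻¹ : ℝ) : ℂ) • x) (Submodule.smul_mem _ _ hx) (by
    rw [norm_smul]; simp [hn.ne'])
  rw [map_smul, norm_smul] at h1
  simp only [Complex.norm_real, norm_inv, norm_norm] at h1
  rwa [inv_mul_le_iff₀ hn, mul_comm] at h1

theorem exists_finiteDimensional_norm_le_forall {A : Fin m → E →L[ℂ] E}
    (hA : ∀ j, IsCompactOperator (A j)) {ε : ℝ} (hε : 0 < ε) :
    ∃ M : Submodule ℂ E, FiniteDimensional ℂ M ∧ ∀ x ∈ Mᗮ, ∀ j, ‖A j x‖ ≤ ε * ‖x‖ := by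
  choose M hM hM' using fun j => (hA j).exists_finiteDimensional_norm_le hε
  refine ⟨⨆ j, M j, inferInstance, fun x hx j => hM' j x ?_⟩
  exact Submodule.orthogonal_le (le_iSup M j) hx

/-- Subspaces on which a real functional of the joint form is bounded below by a positive multiple
of `‖x‖ ^ 2` have bounded dimension. -/
theorem exists_finrank_le_of_jointForm_ge {A : Fin m → E →L[ℂ] E}
    (hA : ∀ j, IsCompactOperator (A j)) (f : (Fin m → ℂ) →L[ℝ] ℝ) {δ : ℝ} (hδ : 0 < δ) :
    ∃ N : ℕ, ∀ L : Submodule ℂ E, (∀ x ∈ L, δ * ‖x‖ ^ 2 ≤ f (jointForm A x)) →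
      FiniteDimensional ℂ L ∧ Module.finrank ℂ L ≤ N := by
  have hpos : 0 < ‖f‖ + 1 := by positivity
  -- With this `ε` the functional is at most `δ / 2 * ‖x‖ ^ 2` on `Mᗮ`, so `L` meets `Mᗮ` trivially
  -- and projects injectively to `M`. The `+ 1` covers `f = 0`.
  obtain ⟨M, hM, hsmall⟩ :=
    exists_finiteDimensional_norm_le_forall hA (ε := δ / 2 / (‖f‖ + 1)) (by positivity)
  refine ⟨Module.finrank ℂ M, fun L hL => ?_⟩
  let P : L →ₗ[ℂ] M := M.orthogonalProjectionOnto.toLinearMap ∘ₗ L.subtype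
  have hinj : Function.Injective P := by
    rw [← LinearMap.ker_eq_bot, Submodule.eq_bot_iff]
    rintro ⟨x, hx⟩ hPx
    have hxM : x ∈ Mᗮ := by
      rw [← Submodule.orthogonalProjectionOnto_eq_zero_iff]
      exact hPx
    have h1 : ‖jointForm A x‖ ≤ δ / 2 / (‖f‖ + 1) * ‖x‖ ^ 2 := by
      refine (pi_norm_le_iff_of_nonneg (by positivity)).mpr fun j => ?_
      calc ‖inner ℂ x (A j x)‖ ≤ ‖x‖ * ‖A j x‖ := norm_inner_le_norm _ _
        _ ≤ ‖x‖ * (δ / 2 / (‖f‖ + 1) * ‖x‖) := by gcongr; exact hsmall x hxM j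
        _ = _ := by ring
    have h2 : f (jointForm A x) ≤ δ / 2 * ‖x‖ ^ 2 := by
      calc f (jointForm A x) ≤ ‖f (jointForm A x)‖ := le_abs_self _
        _ ≤ ‖f‖ * ‖jointForm A x‖ := f.le_opNorm _
        _ ≤ (‖f‖ + 1) * (δ / 2 / (‖f‖ + 1) * ‖x‖ ^ 2) := by
          gcongr; linarith
        _ = δ / 2 * ‖x‖ ^ 2 := by field_simp
    have h3 := hL x hx
    have h4 : ‖x‖ ^ 2 ≤ 0 := by nlinarith
    have h5 : ‖x‖ = 0 := by nlinarith [norm_nonneg x]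
    exact Subtype.ext (norm_eq_zero.mp h5)
  exact ⟨FiniteDimensional.of_injective P hinj, LinearMap.finrank_le_finrank_of_injective hinj⟩

end WeakCompactness

/-! ### Contractive families, their orthonormal dilations, and the closure of the range. -/

section Dilation

/-- A family is contractive if it is the image of the standard basis under a contraction. -/
def IsContractiveFamily {H : Type*} [NormedAddCommGroup H] [InnerProductSpace ℂ H] {k : ℕ}
    (u : Fin k → H) : Prop :=
  ∀ c : Fin k → ℂ, ‖∑ l, c l • u l‖ ^ 2 ≤ ∑ l, ‖c l‖ ^ 2

/-- The sums of the joint form over contractive families of `k` vectors. -/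
def contractiveRange {H : Type*} [NormedAddCommGroup H] [InnerProductSpace ℂ H] {m : ℕ}
    (k : ℕ) (A : Fin m → H →L[ℂ] H) : Set (Fin m → ℂ) :=
  (fun u : Fin k → H => ∑ l, jointForm A (u l)) '' {u | IsContractiveFamily u}

variable {E : Type*} [NormedAddCommGroup E] [InnerProductSpace ℂ E] {m k : ℕ}

theorem inner_self_eq_ofReal_norm_sq (x : E) : inner ℂ x x = ((‖x‖ ^ 2 : ℝ) : ℂ) := by
  rw [inner_self_eq_norm_sq_to_K]; push_cast; rfl

theorem IsContractiveFamily.norm_le_one {u : Fin k → E} (hu : IsContractiveFamily u) (l : Fin k) :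
    ‖u l‖ ≤ 1 := by
  have h := hu (Pi.single l 1)
  simp only [Pi.single_apply, ite_smul, one_smul, zero_smul, Finset.sum_ite_eq', Finset.mem_univ,
    if_true, apply_ite norm, norm_one, norm_zero, ite_pow, one_pow] at h
  simp at h
  exact h

theorem Orthonormal.norm_sum_smul_sq {u : Fin k → E} (hu : Orthonormal ℂ u) (c : Fin k → ℂ) :
    ‖∑ l, c l • u l‖ ^ 2 = ∑ l, ‖c l‖ ^ 2 := by
  have h := hu.inner_sum c c Finset.univ
  rw [inner_self_eq_ofReal_norm_sq] at h
  simp only [conj_mul_self_eq_ofReal] at h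
  exact_mod_cast h

theorem Orthonormal.isContractiveFamily {u : Fin k → E} (hu : Orthonormal ℂ u) :
    IsContractiveFamily u := fun c => (hu.norm_sum_smul_sq c).le

theorem jointNumericalRange_subset_contractiveRange (A : Fin m → E →L[ℂ] E) :
    jointNumericalRange k A ⊆ contractiveRange k A := by
  intro a ha
  obtain ⟨x, hx, rfl⟩ := mem_jointNumericalRange_iff.mp ha
  exact ⟨x, hx.isContractiveFamily, rfl⟩

open Matrix in
open scoped MatrixOrder ComplexOrder in
/-- A contractive family `u` has a complementary family, in the span of any orthonormal family `z`,
whose Gram matrix is the defect `1 - gram u`. -/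
theorem IsContractiveFamily.exists_complement {F : Type*} [NormedAddCommGroup F]
    [InnerProductSpace ℂ F] {u : Fin k → E} (hu : IsContractiveFamily u) {z : Fin k → F}
    (hz : Orthonormal ℂ z) :
    ∃ v : Fin k → F, (∀ l, v l ∈ Submodule.span ℂ (Set.range z)) ∧
      ∀ i l, inner ℂ (v i) (v l) = (if i = l then 1 else 0) - inner ℂ (u i) (u l) := by
  have hpsd : (1 - gram ℂ u).PosSemidef := by
    refine .of_dotProduct_mulVec_nonneg (isHermitian_one.sub (isHermitian_gram ℂ u)) fun c => ?_
    rw [sub_mulVec, dotProduct_sub, star_dotProduct_gram_mulVec, one_mulVec,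
      inner_self_eq_ofReal_norm_sq]
    have h1 : star c ⬝ᵥ c = ((∑ l, ‖c l‖ ^ 2 : ℝ) : ℂ) := by
      simp only [dotProduct, Pi.star_apply, Complex.ofReal_sum]
      refine Finset.sum_congr rfl fun l _ => ?_
      rw [Complex.star_def, conj_mul_self_eq_ofReal]
    rw [h1]
    have h2 := sub_nonneg.mpr (hu c)
    have h3 : (0 : ℂ) ≤ ((∑ l, ‖c l‖ ^ 2 - ‖∑ l, c l • u l‖ ^ 2 : ℝ) : ℂ) := by exact_mod_cast h2
    rwa [Complex.ofReal_sub] at h3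
  rw [← nonneg_iff_posSemidef] at hpsd
  -- The columns of a factor `B` of the defect `star B * B`, used as coordinates along `z`, have the
  -- required Gram matrix.
  obtain ⟨B, hB⟩ := CStarAlgebra.nonneg_iff_eq_star_mul_self.mp hpsd
  refine ⟨fun l => ∑ a, B a l • z a, fun l => Submodule.sum_mem _ fun a _ =>
    Submodule.smul_mem _ _ (Submodule.subset_span ⟨a, rfl⟩), fun i l => ?_⟩
  rw [hz.inner_sum]
  have h := congrFun (congrFun hB i) l
  rw [Matrix.sub_apply, one_apply, gram_apply, star_eq_conjTranspose, mul_apply] at h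
  rw [h]
  rfl

/-- In an infinite-dimensional space, the orthogonal complement of a finite-dimensional subspace
contains orthonormal families of any finite length. -/
theorem exists_orthonormal_orthogonal (hE : ¬ FiniteDimensional ℂ E) (M : Submodule ℂ E)
    [FiniteDimensional ℂ M] (k : ℕ) : ∃ z : Fin k → E, Orthonormal ℂ z ∧ ∀ l, z l ∈ Mᗮ := by
  have hM : ¬ FiniteDimensional ℂ Mᗮ := fun h => hE <| by
    have h1 : FiniteDimensional ℂ (M ⊔ Mᗮ : Submodule ℂ E) := inferInstance
    rw [Submodule.sup_orthogonal_of_hasOrthogonalProjection] at h1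
    exact Submodule.topEquiv.finiteDimensional
  have hr : (k : Cardinal) ≤ Module.rank ℂ Mᗮ := by
    have := mt Module.rank_lt_aleph0_iff.mp hM
    exact Cardinal.natCast_le_aleph0.trans (not_lt.mp this)
  obtain ⟨x, hx⟩ := Module.le_rank_iff.mp hr
  refine ⟨fun l => (InnerProductSpace.gramSchmidtNormed ℂ x l : Mᗮ),
    (InnerProductSpace.gramSchmidtNormed_orthonormal hx).comp_linearIsometry Mᗮ.subtypeₗᵢ,
    fun l => Submodule.coe_mem _⟩

theorem jointForm_add_of_orthogonal {A : Fin m → E →L[ℂ] E} {u v : E}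
    (h1 : ∀ j, inner ℂ u (A j v) = 0) (h2 : ∀ j, inner ℂ v (A j u) = 0) :
    jointForm A (u + v) = jointForm A u + jointForm A v := by
  funext j
  simp [jointForm, h1, h2]

theorem jointForm_oplusZero {F : Type*} [NormedAddCommGroup F] [InnerProductSpace ℂ F]
    (A : Fin m → E →L[ℂ] E) (x : WithLp 2 (E × F)) :
    jointForm (fun j => oplusZero F (A j)) x = jointForm A x.fst := by
  funext j
  change inner ℂ x (WithLp.toLp 2 (A j x.fst, (0 : F))) = _
  rw [WithLp.prod_inner_apply]
  simp [jointForm]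

/-- The joint numerical range of `A ⊕ 0` is the range over contractive families. -/
theorem jointNumericalRange_oplusZero {F : Type*} [NormedAddCommGroup F] [InnerProductSpace ℂ F]
    (A : Fin m → E →L[ℂ] E) {z : Fin k → F} (hz : Orthonormal ℂ z) :
    jointNumericalRange k (fun j => oplusZero F (A j)) = contractiveRange k A := by
  ext a
  rw [mem_jointNumericalRange_iff]
  constructor
  · rintro ⟨x, hx, rfl⟩
    refine ⟨fun l => (x l).fst, fun c => ?_, by simp only [jointForm_oplusZero]⟩
    rw [← hx.norm_sum_smul_sq c, WithLp.prod_norm_sq_eq_of_L2]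
    have : (∑ l, c l • x l).fst = ∑ l, c l • (x l).fst := by
      change WithLp.fstL 2 ℂ E F _ = _
      simp
    rw [this]
    linarith [sq_nonneg ‖(∑ l, c l • x l).snd‖]
  · rintro ⟨u, hu, rfl⟩
    obtain ⟨v, -, hv⟩ := hu.exists_complement hz
    refine ⟨fun l => WithLp.toLp 2 (u l, v l), ?_, by simp [jointForm_oplusZero]⟩
    rw [orthonormal_iff_ite]
    intro i l
    rw [WithLp.prod_inner_apply]
    simp [hv]

variable [CompleteSpace E]

/-- Coordinatewise weak limits of contractive families are contractive, because weak limits do not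
increase the norm of any linear combination. -/
theorem isCompact_contractiveRange {A : Fin m → E →L[ℂ] E} (hA : ∀ j, IsCompactOperator (A j)) :
    IsCompact (contractiveRange k A) := by
  refine isCompact_image_of_ultrafilter fun U hU => ?_
  have hb : ∀ l, ∀ᶠ u in (U : Filter (Fin k → E)), ‖u l‖ ≤ 1 := fun l =>
    mem_of_superset hU fun u hu => IsContractiveFamily.norm_le_one hu l
  choose x hx using fun l => exists_weak_limit U (fun u => u l) (hb l)
  refine ⟨x, fun c => ?_, tendsto_finsetSum _ fun l _ =>
    tendsto_jointForm_of_weak hA (hb l) (hx l)⟩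
  have h1 : ‖∑ l, c l • x l‖ ≤ √(∑ l, ‖c l‖ ^ 2) := by
    refine norm_le_of_weak (U := U) (u := fun u => ∑ l, c l • u l)
      (mem_of_superset hU fun u hu => Real.le_sqrt_of_sq_le (hu c)) fun y => ?_
    simp only [inner_sum, inner_smul_right]
    exact tendsto_finsetSum _ fun l _ => (hx l y).const_mul _
  calc ‖∑ l, c l • x l‖ ^ 2 ≤ √(∑ l, ‖c l‖ ^ 2) ^ 2 := by gcongr
    _ = _ := Real.sq_sqrt (by positivity)

/-- Add to `u` a complementary family `v` inside `H`, orthogonal to `u`, to all `A j u` and adjoints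
applied to `u`, and to a subspace off which the `A j` are small. The sum is orthonormal, cross terms
vanish, and `v` contributes little. -/
theorem contractiveRange_subset_closure (hE : ¬ FiniteDimensional ℂ E) {A : Fin m → E →L[ℂ] E}
    (hA : ∀ j, IsCompactOperator (A j)) :
    contractiveRange k A ⊆ closure (jointNumericalRange k A) := by
  rintro - ⟨u, hu, rfl⟩
  rw [Metric.mem_closure_iff]
  intro ε hε
  -- Each of the `k` error terms is at most `ε / (k + 1)`, which keeps the total strictly below `ε`.
  obtain ⟨M, hM, hsmall⟩ :=
    exists_finiteDimensional_norm_le_forall hA (ε := ε / (k + 1)) (by positivity)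
  let S : Set E := Set.range u ∪ Set.range (fun p : Fin m × Fin k => A p.1 (u p.2)) ∪
    Set.range (fun p : Fin m × Fin k => ContinuousLinearMap.adjoint (A p.1) (u p.2))
  have hS : S.Finite := ((Set.finite_range _).union (Set.finite_range _)).union
    (Set.finite_range _)
  have := FiniteDimensional.span_of_finite ℂ hS
  obtain ⟨z, hz, hzM⟩ := exists_orthonormal_orthogonal hE (M ⊔ Submodule.span ℂ S) k
  obtain ⟨v, hvz, hv⟩ := hu.exists_complement hz
  have hvM : ∀ l, v l ∈ (M ⊔ Submodule.span ℂ S)ᗮ := fun l => by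
    refine Submodule.span_le.mpr ?_ (hvz l)
    rintro - ⟨a, rfl⟩
    exact hzM a
  have hvS : ∀ l, ∀ s ∈ S, inner ℂ s (v l) = 0 := fun l s hs =>
    hvM l s (Submodule.mem_sup_right (Submodule.subset_span hs))
  have huv : ∀ i l, inner ℂ (u i) (v l) = 0 := fun i l => hvS l _ (Or.inl (Or.inl ⟨i, rfl⟩))
  have hAuv : ∀ j i l, inner ℂ (A j (u i)) (v l) = 0 := fun j i l =>
    hvS l _ (Or.inl (Or.inr ⟨(j, i), rfl⟩))
  have huAv : ∀ j i l, inner ℂ (u i) (A j (v l)) = 0 := fun j i l => by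
    rw [← ContinuousLinearMap.adjoint_inner_left]
    exact hvS l _ (Or.inr ⟨(j, i), rfl⟩)
  have hv1 : ∀ l, ‖v l‖ ≤ 1 := fun l => by
    have h := hv l l
    rw [inner_self_eq_ofReal_norm_sq, inner_self_eq_ofReal_norm_sq, if_pos rfl] at h
    have h' : ‖v l‖ ^ 2 = 1 - ‖u l‖ ^ 2 := by exact_mod_cast h
    nlinarith [norm_nonneg (v l), norm_nonneg (u l)]
  refine ⟨∑ l, jointForm A (u l + v l), mem_jointNumericalRange_iff.mpr
    ⟨fun l => u l + v l, ?_, rfl⟩, ?_⟩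
  · rw [orthonormal_iff_ite]
    intro i l
    have h3 : inner ℂ (v i) (u l) = 0 := inner_eq_zero_symm.mp (huv l i)
    simp [inner_add_left, inner_add_right, huv, h3, hv]
  · have h1 : ∀ l, jointForm A (u l + v l) = jointForm A (u l) + jointForm A (v l) := fun l =>
      jointForm_add_of_orthogonal (fun j => huAv j l l)
        (fun j => inner_eq_zero_symm.mp (hAuv j l l))
    simp only [h1, Finset.sum_add_distrib]
    rw [dist_self_add_right]
    have h2 : ∀ l, ‖jointForm A (v l)‖ ≤ ε / (k + 1) := fun l => by
      refine (pi_norm_le_iff_of_nonneg (by positivity)).mpr fun j => ?_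
      calc ‖inner ℂ (v l) (A j (v l))‖ ≤ ‖v l‖ * ‖A j (v l)‖ := norm_inner_le_norm _ _
        _ ≤ ‖v l‖ * (ε / (k + 1) * ‖v l‖) := by
          gcongr
          exact hsmall _ (Submodule.orthogonal_le le_sup_left (hvM l)) j
        _ ≤ 1 * (ε / (k + 1) * 1) := by gcongr <;> exact hv1 l
        _ = _ := by ring
    calc ‖∑ l, jointForm A (v l)‖ ≤ ∑ l : Fin k, ε / (k + 1) :=
          norm_sum_le_of_le _ fun l _ => h2 l
      _ = k * (ε / (k + 1)) := by simp
      _ < ε := by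
        rw [mul_div_assoc', div_lt_iff₀ (by positivity)]
        nlinarith

theorem closure_jointNumericalRange (hE : ¬ FiniteDimensional ℂ E) {A : Fin m → E →L[ℂ] E}
    (hA : ∀ j, IsCompactOperator (A j)) :
    closure (jointNumericalRange k A) = contractiveRange k A :=
  (closure_minimal (jointNumericalRange_subset_contractiveRange A)
    (isCompact_contractiveRange hA).isClosed).antisymm (contractiveRange_subset_closure hE hA)

end Dilation

/-! ### Convex hulls of compact sets in finite dimensions. -/

section ConvexHull

theorem Function.Embedding.sum_extend_zero {α β W : Type*} [Fintype α] [Fintype β]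
    [AddCommMonoid W] (e : α ↪ β) (g : α → W) :
    ∑ i, Function.extend e g 0 i = ∑ i, g i := by
  rw [← Finset.sum_subset (Finset.subset_univ (Finset.univ.map e)) (fun i _ hi => ?_),
    Finset.sum_map]
  · exact Finset.sum_congr rfl fun i _ => e.injective.extend_apply _ _ _
  · rw [Function.extend_apply' _ _ _ (by simpa using hi)]; rfl

/-- In finite dimensions, the convex hull of a compact set is compact. -/
theorem IsCompact.convexHull_of_finiteDimensional {V : Type*} [NormedAddCommGroup V]
    [NormedSpace ℝ V] [FiniteDimensional ℝ V] {s : Set V} (hs : IsCompact s) :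
    IsCompact (convexHull ℝ s) := by
  rcases s.eq_empty_or_nonempty with rfl | ⟨p, hp⟩
  · simp
  -- Carathéodory's number: the hull is the continuous image of a simplex times `N` copies of `s`.
  -- Shorter combinations are padded with weight zero at `p`.
  let N := Module.finrank ℝ V + 1
  let Φ : (Fin N → ℝ) × (Fin N → V) → V := fun q => ∑ i, q.1 i • q.2 i
  have hΦ : Continuous Φ := by fun_prop
  have hc : IsCompact (Φ '' (stdSimplex ℝ (Fin N) ×ˢ Set.univ.pi fun _ => s)) :=
    ((isCompact_stdSimplex ℝ (Fin N)).prod (isCompact_univ_pi fun _ => hs)).image hΦ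
  convert hc using 1
  ext x
  constructor
  · intro hx
    obtain ⟨ι, _, z, w, hz, hai, hw, hw1, rfl⟩ := eq_pos_convex_span_of_mem_convexHull hx
    have hcard : Fintype.card ι ≤ Fintype.card (Fin N) := by
      rw [Fintype.card_fin]
      exact hai.card_le_finrank_succ.trans (Nat.succ_le_succ (Submodule.finrank_le _))
    obtain ⟨e⟩ := Function.Embedding.nonempty_of_card_le hcard
    refine ⟨(Function.extend e w 0, Function.extend e z fun _ => p), ⟨⟨fun i => ?_, ?_⟩,
      fun i _ => ?_⟩, ?_⟩
    · by_cases h : ∃ a, e a = i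
      · obtain ⟨a, rfl⟩ := h
        simpa only [e.injective.extend_apply] using (hw a).le
      · simp only [Function.extend_apply' _ _ _ h]; rfl
    · rw [e.sum_extend_zero, hw1]
    · by_cases h : ∃ a, e a = i
      · obtain ⟨a, rfl⟩ := h
        simpa only [e.injective.extend_apply] using hz ⟨a, rfl⟩
      · simpa only [Function.extend_apply' _ _ _ h] using hp
    · simp only [Φ]
      rw [← e.sum_extend_zero fun i => w i • z i]
      refine Finset.sum_congr rfl fun i _ => ?_
      by_cases h : ∃ a, e a = i
      · obtain ⟨a, rfl⟩ := h
        simp only [e.injective.extend_apply]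
      · simp only [Function.extend_apply' _ _ _ h]; simp
  · rintro ⟨⟨w, z⟩, ⟨hw, hz⟩, rfl⟩
    exact (convex_convexHull ℝ s).sum_mem (fun i _ => hw.1 i) hw.2
      fun i _ => subset_convexHull ℝ s (hz i trivial)

theorem closure_convexHull_of_isCompact_closure {V : Type*} [NormedAddCommGroup V]
    [NormedSpace ℝ V] [FiniteDimensional ℝ V] {s : Set V} (hs : IsCompact (closure s)) :
    closure (convexHull ℝ s) = convexHull ℝ (closure s) :=
  (closure_minimal (convexHull_mono subset_closure)
    hs.convexHull_of_finiteDimensional.isClosed).antisymm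
    (convexHull_min (closure_mono (subset_convexHull ℝ s)) (convex_convexHull ℝ s).closure)

end ConvexHull

/-! ### Forms and projections for finite orthonormal families. -/

section OrthonormalFamilies

variable {E : Type*} [NormedAddCommGroup E] [InnerProductSpace ℂ E] {m : ℕ}

theorem apply_jointForm_le_of_unit_ball {A : Fin m → E →L[ℂ] E} {f : (Fin m → ℂ) →L[ℝ] ℝ}
    {S : Set E} {y : E}
    (hmax : ∀ z : E, ‖z‖ ≤ 1 → (∀ s ∈ S, inner ℂ s z = 0) →
      f (jointForm A z) ≤ f (jointForm A y)) (z : E) (hz : ∀ s ∈ S, inner ℂ s z = 0) :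
    f (jointForm A z) ≤ f (jointForm A y) * ‖z‖ ^ 2 := by
  rcases eq_or_ne z 0 with rfl | h0
  · have : jointForm A (0 : E) = 0 := by funext j; simp [jointForm]
    simp [this]
  have hn : 0 < ‖z‖ := norm_pos_iff.mpr h0
  have h1 := hmax (((‖z‖⁻¹ : ℝ) : ℂ) • z)
    (by rw [norm_smul]; simp [hn.ne'])
    (fun s hs => by rw [inner_smul_right, hz s hs, mul_zero])
  rw [jointForm_smul, map_smul] at h1
  simp only [Complex.norm_real, norm_inv, norm_norm, smul_eq_mul, inv_pow] at h1
  rwa [inv_mul_le_iff₀ (by positivity), mul_comm] at h1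

theorem Orthonormal.snoc {n : ℕ} {e : Fin n → E} (he : Orthonormal ℂ e) {y : E} (hy : ‖y‖ = 1)
    (hey : ∀ i, inner ℂ (e i) y = 0) :
    Orthonormal ℂ (Fin.snoc e y : Fin (n + 1) → E) := by
  have hye : ∀ i, inner ℂ y (e i) = 0 := fun i => inner_eq_zero_symm.mp (hey i)
  constructor
  · intro i
    refine Fin.lastCases ?_ (fun i => ?_) i
    · simpa using hy
    · simpa using he.1 i
  · intro i l
    refine Fin.lastCases ?_ (fun i => ?_) i <;> refine Fin.lastCases ?_ (fun l => ?_) l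
    · simp
    · simpa using fun _ => hye l
    · simpa using hey i
    · intro hil
      simpa using he.2 (fun h => hil (by rw [h]))

variable {ι : Type*} [Fintype ι]

theorem jointForm_sum_smul {A : Fin m → E →L[ℂ] E} {e : ι → E} {μ : ι → Fin m → ℂ}
    (he : Orthonormal ℂ e) (hμ : ∀ i j, A j (e i) = μ i j • e i) (c : ι → ℂ) :
    jointForm A (∑ i, c i • e i) = ∑ i, (‖c i‖ ^ 2) • μ i := by
  funext j
  have h1 : A j (∑ i, c i • e i) = ∑ i, (c i * μ i j) • e i := by
    simp only [map_sum, map_smul, hμ, smul_smul]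
  rw [jointForm, h1, he.inner_sum]
  simp only [Finset.sum_apply, Pi.smul_apply, Complex.real_smul, ← mul_assoc,
    conj_mul_self_eq_ofReal]

theorem inner_sub_sum_eq_zero {e : ι → E} (he : Orthonormal ℂ e) (x : E) (i : ι) :
    inner ℂ (e i) (x - ∑ l, inner ℂ (e l) x • e l) = 0 := by
  rw [inner_sub_right, he.inner_right_fintype, sub_self]

theorem norm_sub_sum_sq {e : ι → E} (he : Orthonormal ℂ e) (x : E) :
    ‖x - ∑ l, inner ℂ (e l) x • e l‖ ^ 2 = ‖x‖ ^ 2 - ∑ i, ‖inner ℂ (e i) x‖ ^ 2 := by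
  have h1 : inner ℂ (∑ l, inner ℂ (e l) x • e l) (x - ∑ l, inner ℂ (e l) x • e l) = (0 : ℂ) := by
    rw [sum_inner]
    refine Finset.sum_eq_zero fun i _ => ?_
    rw [inner_smul_left, inner_sub_sum_eq_zero he, mul_zero]
  have h2 := norm_add_mul_self (𝕜 := ℂ) (∑ l, inner ℂ (e l) x • e l)
    (x - ∑ l, inner ℂ (e l) x • e l)
  rw [h1, add_sub_cancel] at h2
  have h3 : ‖∑ l, inner ℂ (e l) x • e l‖ ^ 2 = ∑ i, ‖inner ℂ (e i) x‖ ^ 2 := by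
    have h := he.inner_sum (fun i => inner ℂ (e i) x) (fun i => inner ℂ (e i) x) Finset.univ
    rw [inner_self_eq_ofReal_norm_sq] at h
    simp only [conj_mul_self_eq_ofReal] at h
    exact_mod_cast h
  rw [← h3]
  simp only [map_zero, mul_zero, add_zero] at h2
  nlinarith

end OrthonormalFamilies

/-! ### Reducing vectors and greedy maximization of a functional. -/

section ReducingEigenvectors

variable {E : Type*} [NormedAddCommGroup E] [InnerProductSpace ℂ E] [CompleteSpace E] {m : ℕ}

/-- `x` is a common eigenvector of `A₁, …, A_m` for `μ`, and of the adjoints for `conj μ`. -/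
def IsReducingVector {H : Type*} [NormedAddCommGroup H] [InnerProductSpace ℂ H] [CompleteSpace H]
    {m : ℕ} (A : Fin m → H →L[ℂ] H) (μ : Fin m → ℂ) (x : H) : Prop :=
  ∀ j, A j x = μ j • x ∧ ContinuousLinearMap.adjoint (A j) x = (starRingEnd ℂ) (μ j) • x

theorem IsReducingVector.smul {A : Fin m → E →L[ℂ] E} {μ : Fin m → ℂ} {x : E}
    (h : IsReducingVector A μ x) (c : ℂ) : IsReducingVector A μ (c • x) := fun j => by
  rw [map_smul, map_smul, (h j).1, (h j).2, smul_comm c, smul_comm c]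
  exact ⟨rfl, rfl⟩

theorem IsReducingVector.jointForm_eq {A : Fin m → E →L[ℂ] E} {μ : Fin m → ℂ} {x : E}
    (h : IsReducingVector A μ x) (hx : ‖x‖ = 1) : jointForm A x = μ := by
  funext j
  rw [jointForm, (h j).1, inner_smul_right, inner_self_eq_ofReal_norm_sq, hx]
  simp

variable {ι : Type*} [Fintype ι]

/-- The span of the `e i` and its complement are both invariant under every `A j`, so there are no
cross terms. -/
theorem jointForm_eq_sum_add {A : Fin m → E →L[ℂ] E} {e : ι → E} {μ : ι → Fin m → ℂ}
    (he : Orthonormal ℂ e) (hμ : ∀ i, IsReducingVector A (μ i) (e i)) (x : E) :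
    jointForm A x = ∑ i, (‖inner ℂ (e i) x‖ ^ 2) • μ i +
      jointForm A (x - ∑ l, inner ℂ (e l) x • e l) := by
  set y := x - ∑ l, inner ℂ (e l) x • e l with hy
  have hy0 : ∀ i, inner ℂ (e i) y = 0 := inner_sub_sum_eq_zero he x
  have hy0' : ∀ i, inner ℂ y (e i) = 0 := fun i => inner_eq_zero_symm.mp (hy0 i)
  rw [← jointForm_sum_smul he (fun i j => (hμ i j).1), ← jointForm_add_of_orthogonal,
    hy, add_sub_cancel]
  · intro j
    rw [← ContinuousLinearMap.adjoint_inner_left, map_sum, sum_inner]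
    refine Finset.sum_eq_zero fun i _ => ?_
    rw [map_smul, (hμ i j).2, inner_smul_left, inner_smul_left, hy0, mul_zero, mul_zero]
  · intro j
    rw [map_sum, inner_sum]
    refine Finset.sum_eq_zero fun i _ => ?_
    rw [map_smul, (hμ i j).1, inner_smul_right, inner_smul_right, hy0', mul_zero, mul_zero]

/-- `e` is an orthonormal family of reducing vectors, at which the functional `f` of the joint form
is at least `t`, while it is at most `t` on the orthogonal complement. -/
structure IsTopFamily {H : Type*} [NormedAddCommGroup H] [InnerProductSpace ℂ H] [CompleteSpace H]
    {m n : ℕ} (A : Fin m → H →L[ℂ] H) (f : (Fin m → ℂ) →L[ℝ] ℝ) (e : Fin n → H)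
    (μ : Fin n → Fin m → ℂ) (t : ℝ) : Prop where
  orthonormal : Orthonormal ℂ e
  reducing : ∀ i, IsReducingVector A (μ i) (e i)
  le_apply : ∀ i, t ≤ f (μ i)
  apply_le : ∀ z, (∀ i, inner ℂ (e i) z = 0) → f (jointForm A z) ≤ t * ‖z‖ ^ 2

variable {n k : ℕ} {A : Fin m → E →L[ℂ] E} {f : (Fin m → ℂ) →L[ℝ] ℝ} {e : Fin n → E}
  {μ : Fin n → Fin m → ℂ} {t : ℝ}

/-- A Ky Fan inequality. -/
theorem IsTopFamily.sum_le (h : IsTopFamily A f e μ t) {x : Fin k → E} (hx : Orthonormal ℂ x) :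
    f (∑ l, jointForm A (x l)) ≤ ∑ i, f (μ i) + (k - n) * t := by
  -- The part of `x l` off the `e i` has squared norm `1 - ∑ i, ‖⟨e i, x l⟩‖ ^ 2` and is charged at
  -- rate `t`. After summing over `l`, Bessel bounds by `1` the weight of each nonnegative `f (μ i)
  -- - t`.
  have h1 : ∀ l, f (jointForm A (x l)) ≤
      ∑ i, ‖inner ℂ (e i) (x l)‖ ^ 2 * (f (μ i) - t) + t := fun l => by
    rw [jointForm_eq_sum_add h.orthonormal h.reducing, map_add, map_sum]
    have h2 := h.apply_le _ (inner_sub_sum_eq_zero h.orthonormal (x l))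
    rw [norm_sub_sum_sq h.orthonormal, hx.1 l] at h2
    simp only [map_smul, smul_eq_mul, mul_sub, Finset.sum_sub_distrib, ← Finset.sum_mul]
    nlinarith
  calc f (∑ l, jointForm A (x l)) = ∑ l, f (jointForm A (x l)) := map_sum f _ _
    _ ≤ ∑ l, (∑ i, ‖inner ℂ (e i) (x l)‖ ^ 2 * (f (μ i) - t) + t) :=
      Finset.sum_le_sum fun l _ => h1 l
    _ = ∑ i, (∑ l, ‖inner ℂ (e i) (x l)‖ ^ 2) * (f (μ i) - t) + k * t := by
      rw [Finset.sum_add_distrib, Finset.sum_comm]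
      simp [Finset.sum_mul]
    _ ≤ ∑ i, 1 * (f (μ i) - t) + k * t := by
      gcongr with i
      · exact sub_nonneg.mpr (h.le_apply i)
      · have h3 := hx.sum_inner_products_le (e i) (s := Finset.univ)
        rw [h.orthonormal.1 i, one_pow] at h3
        simpa only [norm_inner_symm] using h3
    _ = ∑ i, f (μ i) + (k - n) * t := by
      simp [Finset.sum_sub_distrib]; ring

theorem exists_isTopFamily_zero (hA : ∀ j, IsCompactOperator (A j)) (f : (Fin m → ℂ) →L[ℝ] ℝ) :
    ∃ t, 0 ≤ t ∧ IsTopFamily A f (Fin.elim0 : Fin 0 → E) Fin.elim0 t := by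
  obtain ⟨y, -, -, hmax⟩ := exists_max_jointForm hA f ∅
  refine ⟨f (jointForm A y), ?_, ⟨fun i => i.elim0, fun i => i.elim0⟩, fun i => i.elim0,
    fun i => i.elim0, fun z _ => apply_jointForm_le_of_unit_ball hmax z (by simp)⟩
  have h := hmax 0 (by simp) (by simp)
  have h0 : jointForm A (0 : E) = 0 := by funext j; simp [jointForm]
  simpa [h0] using h

/-- If the functional is positive somewhere on the orthogonal complement of a top family, then its
maximum there is attained at a unit vector. -/
theorem IsTopFamily.exists_max (hA : ∀ j, IsCompactOperator (A j)) (h : IsTopFamily A f e μ t)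
    {z₀ : E} (hz₀ : ∀ i, inner ℂ (e i) z₀ = 0) (hpos : 0 < f (jointForm A z₀)) :
    ∃ y, ‖y‖ = 1 ∧ (∀ i, inner ℂ (e i) y = 0) ∧ 0 < f (jointForm A y) ∧ f (jointForm A y) ≤ t ∧
      ∀ z, (∀ i, inner ℂ (e i) z = 0) → f (jointForm A z) ≤ f (jointForm A y) * ‖z‖ ^ 2 := by
  obtain ⟨y, hy1, hye, hmax⟩ := exists_max_jointForm hA f (Set.range e)
  simp only [Set.forall_mem_range] at hye
  have hle : ∀ z, (∀ i, inner ℂ (e i) z = 0) →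
      f (jointForm A z) ≤ f (jointForm A y) * ‖z‖ ^ 2 := fun z hz =>
    apply_jointForm_le_of_unit_ball hmax z (by simpa using hz)
  have hypos : 0 < f (jointForm A y) := by
    have h1 := hle z₀ hz₀
    by_contra hneg
    nlinarith [sq_nonneg ‖z₀‖]
  -- By homogeneity `f` at `y` is at most itself times `‖y‖ ^ 2`; positivity rules out `‖y‖ < 1`.
  have hnorm : ‖y‖ = 1 := by
    refine le_antisymm hy1 ?_
    have h1 := hle y hye
    have h2 : 1 ≤ ‖y‖ ^ 2 := by
      by_contra hlt
      nlinarith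
    nlinarith [norm_nonneg y]
  refine ⟨y, hnorm, hye, hypos, ?_, hle⟩
  simpa [hnorm] using h.apply_le y hye

/-- The greedy step: the threshold drops to the new maximum `f ν`. -/
theorem IsTopFamily.snoc (h : IsTopFamily A f e μ t) {y : E} {ν : Fin m → ℂ} (hy : ‖y‖ = 1)
    (hey : ∀ i, inner ℂ (e i) y = 0) (hν : IsReducingVector A ν y) (hle : f ν ≤ t)
    (hmax : ∀ z, (∀ i, inner ℂ (e i) z = 0) → f (jointForm A z) ≤ f ν * ‖z‖ ^ 2) :
    IsTopFamily A f (Fin.snoc e y : Fin (n + 1) → E) (Fin.snoc μ ν : Fin (n + 1) → Fin m → ℂ)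
      (f ν) where
  orthonormal := h.orthonormal.snoc hy hey
  reducing i := by
    refine Fin.lastCases ?_ (fun i => ?_) i
    · simpa using hν
    · simpa using h.reducing i
  le_apply i := by
    refine Fin.lastCases ?_ (fun i => ?_) i
    · simp
    · simpa using hle.trans (h.le_apply i)
  apply_le z hz := hmax z fun i => by simpa using hz i.castSucc

end ReducingEigenvectors

/-! ### Generic functionals and vertices of polytopes. -/

section Polyhedra

variable {V : Type*} [NormedAddCommGroup V] [NormedSpace ℝ V]

/-- Functionals that do not vanish at any point of a given countable set of nonzero vectors are
dense. -/
theorem dense_setOf_forall_apply_ne_zero {D : Set V} (hD : D.Countable) (h0 : (0 : V) ∉ D) :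
    Dense {f : V →L[ℝ] ℝ | ∀ d ∈ D, f d ≠ 0} := by
  have heq : {f : V →L[ℝ] ℝ | ∀ d ∈ D, f d ≠ 0} = ⋂ d ∈ D, {f : V →L[ℝ] ℝ | f d ≠ 0} := by
    ext f; simp
  rw [heq]
  have hcont : ∀ d : V, Continuous fun f : V →L[ℝ] ℝ => f d := fun d => by fun_prop
  refine dense_biInter_of_isOpen (fun d _ => isOpen_ne_fun (hcont d) continuous_const) hD
    fun d hd => ?_
  -- The functionals killing `d` form a subspace, proper by Hahn–Banach, hence with empty interior;
  -- Baire's theorem handles countably many `d`.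
  let L : Submodule ℝ (V →L[ℝ] ℝ) := LinearMap.ker (ContinuousLinearMap.apply ℝ ℝ d).toLinearMap
  have hL : {f : V →L[ℝ] ℝ | f d ≠ 0} = (L : Set (V →L[ℝ] ℝ))ᶜ := by
    ext f; simp [L]
  rw [hL, ← interior_eq_empty_iff_dense_compl]
  by_contra hne
  have htop := L.eq_top_of_nonempty_interior' (Set.nonempty_iff_ne_empty.mpr hne)
  obtain ⟨g, -, hg⟩ := exists_dual_vector ℝ d (norm_ne_zero_iff.mpr fun h => h0 (h ▸ hd))
  have hgL : g ∈ L := htop ▸ Submodule.mem_top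
  have hgd : g d = 0 := hgL
  rw [hgd] at hg
  have hd0 : ‖d‖ = 0 := hg.symm
  exact h0 (norm_eq_zero.mp hd0 ▸ hd)

/-- Near a vertex at which `f` has its strict maximum, a polytope is contained in a cone on which
the distance to the vertex is controlled by `f`. -/
theorem exists_norm_sub_le_of_strict_max {F : Set V} (hF : F.Finite) {f : V →L[ℝ] ℝ} {v : V}
    (hv : ∀ p ∈ F, p ≠ v → f p < f v) :
    ∃ C, ∀ w ∈ convexHull ℝ F, ‖w - v‖ ≤ C * (f v - f w) := by
  -- The sum dominates each ratio at a point `p ≠ v`; a term at `v` is `0 / 0 = 0`.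
  let C := ∑ p ∈ hF.toFinset, ‖p - v‖ / (f v - f p)
  have hle : ∀ p ∈ F, 0 ≤ f v - f p := fun p hp => by
    rcases eq_or_ne p v with rfl | h
    · simp
    · exact (sub_pos.mpr (hv p hp h)).le
  refine ⟨C, fun w hw => ?_⟩
  have hconv : Convex ℝ {w : V | ‖w - v‖ ≤ C * (f v - f w)} := by
    intro p hp q hq a b ha hb hab
    simp only [Set.mem_ofPred_eq] at hp hq ⊢
    have h1 : a • p + b • q - v = a • (p - v) + b • (q - v) := by
      rw [smul_sub, smul_sub, sub_add_sub_comm, ← add_smul, hab, one_smul]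
    have h2 : f v = a * f v + b * f v := by rw [← add_mul, hab, one_mul]
    calc ‖a • p + b • q - v‖ ≤ ‖a • (p - v)‖ + ‖b • (q - v)‖ := by
          rw [h1]; exact norm_add_le _ _
      _ = a * ‖p - v‖ + b * ‖q - v‖ := by
          rw [norm_smul, norm_smul, Real.norm_of_nonneg ha, Real.norm_of_nonneg hb]
      _ ≤ a * (C * (f v - f p)) + b * (C * (f v - f q)) := by gcongr
      _ = C * (f v - f (a • p + b • q)) := by
          rw [map_add, map_smul, map_smul, smul_eq_mul, smul_eq_mul]
          linear_combination (-C) * h2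
  refine convexHull_min (fun p hp => ?_) hconv hw
  rcases eq_or_ne p v with rfl | h
  · simp
  have h3 : ‖p - v‖ / (f v - f p) ≤ C :=
    Finset.single_le_sum (f := fun p => ‖p - v‖ / (f v - f p))
      (fun q hq => div_nonneg (norm_nonneg _) (hle q (hF.mem_toFinset.mp hq)))
      (hF.mem_toFinset.mpr hp)
  exact (div_le_iff₀ (sub_pos.mpr (hv p hp h))).mp h3

theorem exists_mem_forall_le_of_mem_convexHull {F : Set V} (hF : F.Finite) (f : V →L[ℝ] ℝ) {v : V}
    (hv : v ∈ convexHull ℝ F) :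
    ∃ p ∈ F, (∀ q ∈ F, f q ≤ f p) ∧ ∀ w ∈ convexHull ℝ F, f w ≤ f p := by
  have hne : F.Nonempty := convexHull_nonempty_iff.mp ⟨v, hv⟩
  obtain ⟨p, hp, hmax⟩ := hF.exists_maximalFor f F hne
  have hmax' : ∀ q ∈ F, f q ≤ f p := fun q hq => by
    by_contra h
    exact h (hmax hq (not_le.mp h).le)
  refine ⟨p, hp, hmax', fun w hw => ?_⟩
  exact convexHull_min (t := {w | f w ≤ f p}) hmax' (convex_halfSpace_le f.isLinear _) hw

/-- Injectivity on `F` makes the top vertex `p` a strict maximum. Since `f v = f p`, the cone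
inequality at `p` forces `v = p`. -/
theorem exists_norm_sub_le_of_polyhedral {W F : Set V} (hF : F.Finite)
    (hWF : closure (convexHull ℝ W) = convexHull ℝ F) {f : V →L[ℝ] ℝ} (hf : F.InjOn f) {v : V}
    (hv : v ∈ W) (hmax : ∀ w ∈ W, f w ≤ f v) :
    ∃ C, ∀ w ∈ W, ‖w - v‖ ≤ C * (f v - f w) := by
  have hsub : W ⊆ convexHull ℝ F := hWF ▸ (subset_convexHull ℝ W).trans subset_closure
  obtain ⟨p, hp, hpF, hpc⟩ := exists_mem_forall_le_of_mem_convexHull hF f (hsub hv)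
  obtain ⟨C, hC⟩ := exists_norm_sub_le_of_strict_max hF (f := f) (v := p) fun q hq hqp =>
    lt_of_le_of_ne (hpF q hq) fun h => hqp (hf hq hp h)
  have hpv : f p ≤ f v := by
    have h1 : closure (convexHull ℝ W) ⊆ {w | f w ≤ f v} :=
      closure_minimal (convexHull_min hmax (convex_halfSpace_le f.isLinear _))
        (isClosed_le f.continuous continuous_const)
    exact h1 (hWF ▸ subset_convexHull ℝ F hp)
  have hvp : v = p := by
    have h2 := hC v (hsub hv)
    rw [le_antisymm hpv (hpc v (hsub hv)), sub_self, mul_zero] at h2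
    exact sub_eq_zero.mp (norm_le_zero_iff.mp h2)
  exact ⟨C, fun w hw => hvp ▸ hC w (hsub hw)⟩

end Polyhedra

/-! ### Conical points yield reducing vectors; polyhedrality yields commuting normal operators. -/

section Perturbation

variable {E : Type*} [NormedAddCommGroup E] [InnerProductSpace ℂ E] {m n : ℕ}
  {A : Fin m → E →L[ℂ] E} {f : (Fin m → ℂ) →L[ℝ] ℝ} {e : Fin n → E}

/-- Factoring out `sin θ` allows it to be cancelled from the cone inequality; letting `θ → 0` then
isolates the first variation. -/
theorem jointForm_cos_sin (A : Fin m → E →L[ℂ] E) (y z : E) (θ : ℝ) :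
    jointForm A ((Real.cos θ : ℂ) • y + (Real.sin θ : ℂ) • z) - jointForm A y =
      Real.sin θ • (Real.cos θ • (fun j => inner ℂ y (A j z) + inner ℂ z (A j y)) +
        Real.sin θ • (jointForm A z - jointForm A y)) := by
  funext j
  have h : (Real.cos θ : ℂ) ^ 2 = 1 - (Real.sin θ : ℂ) ^ 2 := by
    rw [← Complex.ofReal_pow, Real.cos_sq']; push_cast; rfl
  simp only [jointForm, map_add, map_smul, inner_add_left, inner_add_right, inner_smul_left,
    inner_smul_right, Pi.sub_apply, Pi.smul_apply, Pi.add_apply, Complex.real_smul,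
    Complex.conj_ofReal]
  linear_combination (inner ℂ y (A j y)) * h

/-- At a conical point of the joint numerical range, the first variation vanishes. -/
theorem inner_add_inner_eq_zero_of_conical {y : E}
    (hey : Orthonormal ℂ (Fin.snoc e y : Fin (n + 1) → E)) {C : ℝ}
    (hC : ∀ w ∈ jointNumericalRange (n + 1) A,
      ‖w - (∑ i, jointForm A (e i) + jointForm A y)‖ ≤
        C * (f (∑ i, jointForm A (e i) + jointForm A y) - f w))
    {z : E} (hz : ‖z‖ = 1) (hez : ∀ i, inner ℂ (e i) z = 0) (hyz : inner ℂ y z = 0) (j : Fin m) :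
    inner ℂ y (A j z) + inner ℂ z (A j y) = 0 := by
  have he : Orthonormal ℂ e := by
    have := hey.comp Fin.castSucc (Fin.castSucc_injective n)
    simpa [Function.comp_def] using this
  have hy1 : ‖y‖ = 1 := by simpa using hey.1 (Fin.last n)
  have hey0 : ∀ i, inner ℂ (e i) y = 0 := fun i => by
    simpa using hey.2 (Fin.castSucc_lt_last i).ne
  have key : ∀ z : E, ‖z‖ = 1 → (∀ i, inner ℂ (e i) z = 0) → inner ℂ y z = 0 →
      ‖(fun j => inner ℂ y (A j z) + inner ℂ z (A j y) : Fin m → ℂ)‖ ≤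
        C * -f (fun j => inner ℂ y (A j z) + inner ℂ z (A j y)) := by
    intro z hz hez hyz
    set Z : Fin m → ℂ := fun j => inner ℂ y (A j z) + inner ℂ z (A j y) with hZ
    set D := jointForm A z - jointForm A y with hD
    have h1 : ∀ θ ∈ Set.Ioo (0 : ℝ) 1, ‖Real.cos θ • Z + Real.sin θ • D‖ ≤
        C * -f (Real.cos θ • Z + Real.sin θ • D) := by
      intro θ hθ
      have hs : 0 < Real.sin θ :=
        Real.sin_pos_of_pos_of_lt_pi hθ.1 (hθ.2.trans (by linarith [Real.pi_gt_three]))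
      let x := (Real.cos θ : ℂ) • y + (Real.sin θ : ℂ) • z
      have hx1 : ‖x‖ = 1 := by
        have h2 : inner ℂ x x = 1 := by
          simp only [x, inner_add_left, inner_add_right, inner_smul_left, inner_smul_right, hyz,
            inner_eq_zero_symm.mp hyz, inner_self_eq_ofReal_norm_sq, hz, hy1, Complex.conj_ofReal]
          have := Real.cos_sq_add_sin_sq θ
          have h3 : (Real.cos θ : ℂ) ^ 2 + (Real.sin θ : ℂ) ^ 2 = 1 := by exact_mod_cast this
          simp only [one_pow, Complex.ofReal_one]
          linear_combination h3
        rw [inner_self_eq_ofReal_norm_sq] at h2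
        have h3 : ‖x‖ ^ 2 = 1 := by exact_mod_cast h2
        nlinarith [norm_nonneg x]
      have hex : ∀ i, inner ℂ (e i) x = 0 := fun i => by
        rw [inner_add_right, inner_smul_right, inner_smul_right, hey0, hez, mul_zero, mul_zero,
          add_zero]
      have h4 := hC (∑ i, jointForm A (e i) + jointForm A x)
        (mem_jointNumericalRange_iff.mpr ⟨Fin.snoc e x, he.snoc hx1 hex, by
          rw [Fin.sum_univ_castSucc]; simp⟩)
      rw [← neg_sub (f _) (f _), ← map_sub, add_sub_add_left_eq_sub, jointForm_cos_sin,
        norm_smul, map_smul, Real.norm_of_nonneg hs.le, smul_eq_mul] at h4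
      refine le_of_mul_le_mul_left (h4.trans_eq ?_) hs
      ring
    have h5 : IsClosed {θ : ℝ | ‖Real.cos θ • Z + Real.sin θ • D‖ ≤
        C * -f (Real.cos θ • Z + Real.sin θ • D)} :=
      isClosed_le (by fun_prop) (by fun_prop)
    have h6 := closure_minimal (s := Set.Ioo (0 : ℝ) 1) h1 h5
    rw [closure_Ioo zero_ne_one] at h6
    have h7 : ‖Real.cos 0 • Z + Real.sin 0 • D‖ ≤ C * -f (Real.cos 0 • Z + Real.sin 0 • D) :=
      h6 (Set.left_mem_Icc.mpr zero_le_one)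
    simpa only [Real.cos_zero, Real.sin_zero, one_smul, zero_smul, add_zero] using h7
  -- The first variation `Z` is odd in `z`, so `key` gives both `‖Z‖ ≤ -C * f Z` and `‖Z‖ ≤ C * f
  -- Z`; adding them yields `Z = 0`.
  have h1 := key z hz hez hyz
  have h2 := key (-z) (by rwa [norm_neg]) (fun i => by rw [inner_neg_right, hez, neg_zero])
    (by rw [inner_neg_right, hyz, neg_zero])
  have h3 : (fun j => inner ℂ y (A j (-z)) + inner ℂ (-z) (A j y) : Fin m → ℂ) =
      -(fun j => inner ℂ y (A j z) + inner ℂ z (A j y)) := by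
    funext j
    simp only [map_neg, inner_neg_right, inner_neg_left, Pi.neg_apply]
    ring
  rw [h3, norm_neg, map_neg, neg_neg] at h2
  have h4 : ‖(fun j => inner ℂ y (A j z) + inner ℂ z (A j y) : Fin m → ℂ)‖ ≤ 0 := by linarith
  exact congrFun (norm_le_zero_iff.mp h4) j

variable [CompleteSpace E]

/-- Vanishing variations along `z` and `i z` separate into `⟨y, A z⟩ = 0` and `⟨z, A y⟩ = 0`. The
components of `A y` and of the adjoint at `y` orthogonal to `y` are admissible choices of `z`, the
`e i` being reducing, so they are zero. -/
theorem isReducingVector_of_conical {μ : Fin n → Fin m → ℂ}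
    (hμ : ∀ i, IsReducingVector A (μ i) (e i)) {y : E}
    (hey : Orthonormal ℂ (Fin.snoc e y : Fin (n + 1) → E)) {C : ℝ}
    (hC : ∀ w ∈ jointNumericalRange (n + 1) A,
      ‖w - (∑ i, jointForm A (e i) + jointForm A y)‖ ≤
        C * (f (∑ i, jointForm A (e i) + jointForm A y) - f w)) :
    IsReducingVector A (jointForm A y) y := by
  have hy1 : ‖y‖ = 1 := by simpa using hey.1 (Fin.last n)
  have hyy : inner ℂ y y = (1 : ℂ) := by rw [inner_self_eq_ofReal_norm_sq, hy1]; simp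
  have hey0 : ∀ i, inner ℂ (e i) y = 0 := fun i => by
    simpa using hey.2 (Fin.castSucc_lt_last i).ne
  have key : ∀ z : E, (∀ i, inner ℂ (e i) z = 0) → inner ℂ y z = 0 → ∀ j,
      inner ℂ y (A j z) = 0 ∧ inner ℂ z (A j y) = 0 := by
    have hunit : ∀ z : E, ‖z‖ = 1 → (∀ i, inner ℂ (e i) z = 0) → inner ℂ y z = 0 → ∀ j,
        inner ℂ y (A j z) = 0 ∧ inner ℂ z (A j y) = 0 := by
      intro z hz hez hyz j
      have h1 := inner_add_inner_eq_zero_of_conical hey hC hz hez hyz j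
      have h2 := inner_add_inner_eq_zero_of_conical hey hC (z := Complex.I • z)
        (by rw [norm_smul, hz]; simp) (fun i => by rw [inner_smul_right, hez, mul_zero])
        (by rw [inner_smul_right, hyz, mul_zero]) j
      rw [map_smul, inner_smul_right, inner_smul_left, Complex.conj_I] at h2
      have h3 : inner ℂ y (A j z) - inner ℂ z (A j y) = 0 := by
        have h4 : Complex.I * (inner ℂ y (A j z) - inner ℂ z (A j y)) = 0 := by
          linear_combination h2
        simpa using h4
      constructor
      · linear_combination (h1 + h3) / 2
      · linear_combination (h1 - h3) / 2
    intro z hez hyz j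
    rcases eq_or_ne z 0 with rfl | h0
    · simp
    have hn : ‖z‖ ≠ 0 := norm_ne_zero_iff.mpr h0
    have h1 := hunit (((‖z‖⁻¹ : ℝ) : ℂ) • z)
      (by rw [norm_smul]; simp [hn]) (fun i => by rw [inner_smul_right, hez, mul_zero])
      (by rw [inner_smul_right, hyz, mul_zero]) j
    simpa [inner_smul_right, inner_smul_left, hn] using h1
  intro j
  constructor
  · set z := A j y - inner ℂ y (A j y) • y with hz
    have hyz : inner ℂ y z = 0 := by
      rw [hz, inner_sub_right, inner_smul_right, hyy, mul_one, sub_self]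
    have hez : ∀ i, inner ℂ (e i) z = 0 := fun i => by
      rw [hz, inner_sub_right, inner_smul_right, hey0, mul_zero, sub_zero,
        ← ContinuousLinearMap.adjoint_inner_left, (hμ i j).2, inner_smul_left, hey0, mul_zero]
    have h1 : inner ℂ z z = (0 : ℂ) := by
      nth_rw 2 [hz]
      rw [inner_sub_right, (key z hez hyz j).2, inner_smul_right, inner_eq_zero_symm.mp hyz,
        mul_zero, sub_zero]
    exact sub_eq_zero.mp (inner_self_eq_zero.mp h1)
  · set z := ContinuousLinearMap.adjoint (A j) y - (starRingEnd ℂ) (inner ℂ y (A j y)) • y with hz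
    have hyz : inner ℂ y z = 0 := by
      rw [hz, inner_sub_right, inner_smul_right, hyy, mul_one,
        ContinuousLinearMap.adjoint_inner_right, inner_conj_symm, sub_self]
    have hez : ∀ i, inner ℂ (e i) z = 0 := fun i => by
      rw [hz, inner_sub_right, inner_smul_right, hey0, mul_zero, sub_zero,
        ContinuousLinearMap.adjoint_inner_right, (hμ i j).1, inner_smul_left, hey0, mul_zero]
    have h1 : inner ℂ z z = (0 : ℂ) := by
      nth_rw 1 [hz]
      rw [inner_sub_left, ContinuousLinearMap.adjoint_inner_left, (key z hez hyz j).1,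
        inner_smul_left, hyz, mul_zero, sub_zero]
    exact sub_eq_zero.mp (inner_self_eq_zero.mp h1)

/-- A functional that is generic for the polyhedra `closure (conv W_k(A))` cannot be positive on
the joint form at a vector orthogonal to all reducing vectors. -/
theorem apply_jointForm_nonpos_of_generic (hA : ∀ j, IsCompactOperator (A j))
    {F : ℕ → Set (Fin m → ℂ)} (hF : ∀ k, (F k).Finite)
    (hWF : ∀ k, closure (convexHull ℝ (jointNumericalRange (k + 1) A)) = convexHull ℝ (F k))
    (hf : ∀ k, (F k).InjOn f) {z₀ : E}
    (hz₀ : ∀ μ x, IsReducingVector A μ x → inner ℂ x z₀ = 0) : f (jointForm A z₀) ≤ 0 := by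
  by_contra hpos
  rw [not_le] at hpos
  have hz₀n : 0 < ‖z₀‖ := norm_pos_iff.mpr fun h => by
    have : jointForm A (0 : E) = 0 := by funext j; simp [jointForm]
    simp [h, this] at hpos
  -- The vector `z₀` is orthogonal to every reducing vector found so far, so a positive value always
  -- remains available and the greedy choice never stops.
  have hex : ∀ n, ∃ (e : Fin n → E) (μ : Fin n → Fin m → ℂ) (t : ℝ), IsTopFamily A f e μ t := by
    intro n
    induction n with
    | zero =>
      obtain ⟨t, -, h⟩ := exists_isTopFamily_zero hA f
      exact ⟨_, _, t, h⟩
    | succ n ih =>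
      obtain ⟨e, μ, t, h⟩ := ih
      obtain ⟨y, hy, hey, hy0, hyt, hmax⟩ :=
        h.exists_max hA (fun i => hz₀ _ _ (h.reducing i)) hpos
      have hort := h.orthonormal.snoc hy hey
      have hsum : ∑ i, jointForm A (e i) + jointForm A y = ∑ i, μ i + jointForm A y := by
        rw [Finset.sum_congr rfl fun i _ => (h.reducing i).jointForm_eq (h.orthonormal.1 i)]
      have hvmem : ∑ i, jointForm A (e i) + jointForm A y ∈ jointNumericalRange (n + 1) A :=
        mem_jointNumericalRange_iff.mpr ⟨_, hort, by rw [Fin.sum_univ_castSucc]; simp⟩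
      -- Lowering the threshold to the new maximum makes the Ky Fan bound for `n + 1` vectors equal
      -- to the value at the extended family.
      have htop : IsTopFamily A f e μ (f (jointForm A y)) :=
        ⟨h.orthonormal, h.reducing, fun i => hyt.trans (h.le_apply i), hmax⟩
      obtain ⟨C, hC⟩ := exists_norm_sub_le_of_polyhedral (hF n) (hWF n) (hf n) hvmem (by
        intro w hw
        obtain ⟨x, hx, rfl⟩ := mem_jointNumericalRange_iff.mp hw
        have h1 := htop.sum_le hx
        rw [hsum, map_add, map_sum f μ]
        push_cast at h1
        linarith)
      have hred := isReducingVector_of_conical h.reducing hort hC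
      exact ⟨_, _, _, h.snoc hy hey hred hyt hmax⟩
  -- Every threshold is at least this fixed `δ > 0`, so a family of length `N + 1` spans too large a
  -- subspace.
  obtain ⟨N, hN⟩ := exists_finrank_le_of_jointForm_ge hA f
    (δ := f (jointForm A z₀) / ‖z₀‖ ^ 2) (by positivity)
  obtain ⟨e, μ, t, h⟩ := hex (N + 1)
  have hδ : f (jointForm A z₀) / ‖z₀‖ ^ 2 ≤ t := by
    rw [div_le_iff₀ (by positivity)]
    exact h.apply_le z₀ fun i => hz₀ _ _ (h.reducing i)
  have h1 := (hN (Submodule.span ℂ (Set.range e)) ?_).2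
  · rw [finrank_span_eq_card h.orthonormal.linearIndependent, Fintype.card_fin] at h1
    omega
  · intro x hx
    obtain ⟨c, rfl⟩ := (Submodule.mem_span_range_iff_exists_fun ℂ).mp hx
    rw [h.orthonormal.norm_sum_smul_sq, jointForm_sum_smul h.orthonormal
      (fun i j => (h.reducing i j).1), map_sum, Finset.mul_sum]
    refine Finset.sum_le_sum fun i _ => ?_
    rw [map_smul, smul_eq_mul, mul_comm]
    gcongr
    exact hδ.trans (h.le_apply i)

/-- If all `closure (conv W_k(A))` are polyhedral, then no nonzero vector is orthogonal to all
reducing vectors. -/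
theorem eq_zero_of_orthogonal_isReducingVector (hA : ∀ j, IsCompactOperator (A j))
    (hpoly : ∀ k : ℕ, 1 ≤ k → IsPolyhedral (closure (convexHull ℝ (jointNumericalRange k A))))
    {z : E} (hz : ∀ μ x, IsReducingVector A μ x → inner ℂ x z = 0) : z = 0 := by
  choose F hF hWF using fun k : ℕ => hpoly (k + 1) (Nat.le_add_left 1 k)
  -- A functional nonzero on all differences of distinct points of `F k` is injective on every `F
  -- k`.
  let D : Set (Fin m → ℂ) := ⋃ k, (fun p : (Fin m → ℂ) × (Fin m → ℂ) => p.1 - p.2) ''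
    ((F k ×ˢ F k) ∩ {p | p.1 ≠ p.2})
  have hD : D.Countable := Set.countable_iUnion fun k =>
    ((((hF k).prod (hF k)).subset Set.inter_subset_left).image _).countable
  have hD0 : (0 : Fin m → ℂ) ∉ D := by
    simp only [D, Set.mem_iUnion, not_exists]
    rintro k ⟨p, ⟨-, hp⟩, hp0⟩
    exact hp (sub_eq_zero.mp hp0)
  have hinj : ∀ f : (Fin m → ℂ) →L[ℝ] ℝ, (∀ d ∈ D, f d ≠ 0) → ∀ k, (F k).InjOn f := by
    intro f hf k p hp q hq hpq
    by_contra hne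
    refine hf (p - q) (Set.mem_iUnion.mpr ⟨k, (p, q), ⟨⟨hp, hq⟩, hne⟩, rfl⟩) ?_
    rw [map_sub, hpq, sub_self]
  have hnonpos : ∀ z : E, (∀ μ x, IsReducingVector A μ x → inner ℂ x z = 0) →
      ∀ f : (Fin m → ℂ) →L[ℝ] ℝ, f (jointForm A z) ≤ 0 := by
    intro z hz f
    have h1 : closure {f : (Fin m → ℂ) →L[ℝ] ℝ | ∀ d ∈ D, f d ≠ 0} ⊆
        {f | f (jointForm A z) ≤ 0} :=
      closure_minimal
        (fun f hf => apply_jointForm_nonpos_of_generic hA hF hWF (hinj f hf) hz)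
        (isClosed_le (by fun_prop) continuous_const)
    exact h1 (dense_setOf_forall_apply_ne_zero hD hD0 f)
  have hform : ∀ z : E, (∀ μ x, IsReducingVector A μ x → inner ℂ x z = 0) →
      jointForm A z = 0 := by
    intro z hz
    by_contra hne
    obtain ⟨g, -, hg⟩ := exists_dual_vector ℝ (jointForm A z) (norm_ne_zero_iff.mpr hne)
    have h1 := hnonpos z hz g
    rw [hg] at h1
    exact hne (norm_le_zero_iff.mp h1)
  have hinner : ∀ z w : E, (∀ μ x, IsReducingVector A μ x → inner ℂ x z = 0) →
      (∀ μ x, IsReducingVector A μ x → inner ℂ x w = 0) → ∀ j, inner ℂ z (A j w) = 0 := by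
    intro z w hz hw j
    -- Polarization with `c = 1` and `c = i`.
    have hs : ∀ c : ℂ, inner ℂ (z + c • w) (A j (z + c • w)) = 0 := fun c =>
      congrFun (hform (z + c • w) fun μ x hx => by
        rw [inner_add_right, inner_smul_right, hz μ x hx, hw μ x hx, mul_zero, add_zero]) j
    have h0 : inner ℂ z (A j z) = 0 := congrFun (hform z hz) j
    have h1 : inner ℂ w (A j w) = 0 := congrFun (hform w hw) j
    have h2 := hs 1
    have h3 := hs Complex.I
    simp only [map_add, map_smul, inner_add_left, inner_add_right, inner_smul_left,
      inner_smul_right, h0, h1, Complex.conj_I, map_one] at h2 h3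
    have h4 : inner ℂ z (A j w) - inner ℂ w (A j z) = 0 := by
      have h5 : Complex.I * (inner ℂ z (A j w) - inner ℂ w (A j z)) = 0 := by
        linear_combination h3
      simpa using h5
    linear_combination (h2 + h4) / 2
  -- Vectors orthogonal to all reducing vectors form a space invariant under each `A j` and its
  -- adjoint, on which all forms vanish. Thus `z` is killed by all of them, is itself reducing, and
  -- is orthogonal to itself.
  have hAz : ∀ j, A j z = 0 := fun j => by
    refine inner_self_eq_zero (𝕜 := ℂ).mp (hinner (A j z) z (fun μ x hx => ?_) hz j)
    rw [← ContinuousLinearMap.adjoint_inner_left, (hx j).2, inner_smul_left, hz μ x hx, mul_zero]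
  have hAz' : ∀ j, ContinuousLinearMap.adjoint (A j) z = 0 := fun j => by
    have h1 := hinner z (ContinuousLinearMap.adjoint (A j) z) hz (fun μ x hx => by
      rw [ContinuousLinearMap.adjoint_inner_right, (hx j).1, inner_smul_left, hz μ x hx,
        mul_zero]) j
    rw [← ContinuousLinearMap.adjoint_inner_left] at h1
    exact inner_self_eq_zero.mp h1
  exact inner_self_eq_zero.mp (hz 0 z fun j => by simp [hAz, hAz'])

/-- The equality locus is a closed subspace containing all reducing vectors, so its orthogonal
complement is trivial. -/
theorem ext_of_eq_on_isReducingVector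
    (htotal : ∀ z : E, (∀ μ x, IsReducingVector A μ x → inner ℂ x z = 0) → z = 0)
    {S T : E →L[ℂ] E} (h : ∀ μ x, IsReducingVector A μ x → S x = T x) : S = T := by
  have h1 : (LinearMap.eqLocus S.toLinearMap T.toLinearMap)ᗮ = ⊥ := by
    rw [Submodule.eq_bot_iff]
    exact fun z hz => htotal z fun μ x hx => hz x (h μ x hx)
  have hclosed : IsClosed (LinearMap.eqLocus S.toLinearMap T.toLinearMap : Set E) :=
    isClosed_eq S.continuous T.continuous
  have := hclosed.completeSpace_coe
  rw [Submodule.orthogonal_eq_bot_iff] at h1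
  ext x
  exact (h1 ▸ Submodule.mem_top : x ∈ LinearMap.eqLocus S.toLinearMap T.toLinearMap)

theorem isStarNormal_and_commute_of_polyhedral (hA : ∀ j, IsCompactOperator (A j))
    (hpoly : ∀ k : ℕ, 1 ≤ k → IsPolyhedral (closure (convexHull ℝ (jointNumericalRange k A)))) :
    (∀ j, IsStarNormal (A j)) ∧ ∀ i j, Commute (A i) (A j) := by
  have htotal := fun z : E => eq_zero_of_orthogonal_isReducingVector hA hpoly (z := z)
  refine ⟨fun j => ⟨?_⟩, fun i j => ?_⟩
  · refine ext_of_eq_on_isReducingVector htotal fun μ x hx => ?_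
    rw [ContinuousLinearMap.star_eq_adjoint]
    simp only [mul_apply_eq_comp, (hx j).1, (hx j).2, map_smul]
    exact smul_comm _ _ _
  · refine ext_of_eq_on_isReducingVector htotal fun μ x hx => ?_
    simp only [mul_apply_eq_comp, (hx j).1, (hx i).1, map_smul]
    exact smul_comm _ _ _

end Perturbation

/-! ### Commuting normal compact operators: maxima attained at common eigenvectors. -/

section CommutingNormal

variable {E : Type*} [NormedAddCommGroup E] [InnerProductSpace ℂ E] {m n k : ℕ}
  {A : Fin m → E →L[ℂ] E}

/-- Commuting operators have a common eigenvector in each nonzero finite-dimensional invariant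
subspace. -/
theorem exists_common_eigenvector (hcomm : ∀ i j, Commute (A i) (A j)) {L : Submodule ℂ E}
    (hL : FiniteDimensional ℂ L) (hne : L ≠ ⊥) (hinv : ∀ j, ∀ x ∈ L, A j x ∈ L) :
    ∃ x ∈ L, x ≠ 0 ∧ ∃ ν : Fin m → ℂ, ∀ j, A j x = ν j • x := by
  -- One operator at a time: cutting down to an eigenspace of `A j` keeps invariance under the
  -- others by commutation.
  suffices h : ∀ s : Finset (Fin m), ∃ L' ≤ L, L' ≠ ⊥ ∧ (∀ j, ∀ x ∈ L', A j x ∈ L') ∧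
      ∀ j ∈ s, ∃ ν : ℂ, ∀ x ∈ L', A j x = ν • x by
    obtain ⟨L', hle, hne', -, hν⟩ := h Finset.univ
    obtain ⟨x, hx, hx0⟩ := L'.exists_mem_ne_zero_of_ne_bot hne'
    choose ν hν using fun j => hν j (Finset.mem_univ j)
    exact ⟨x, hle hx, hx0, ν, fun j => hν j x hx⟩
  intro s
  induction s using Finset.induction_on with
  | empty => exact ⟨L, le_rfl, hne, hinv, by simp⟩
  | insert j s hj ih =>
    obtain ⟨L', hle, hne', hinv', hs⟩ := ih
    have : FiniteDimensional ℂ L' := Submodule.finiteDimensional_of_le hle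
    have : Nontrivial L' := Submodule.nontrivial_iff_ne_bot.mpr hne'
    obtain ⟨ν, hν⟩ := Module.End.exists_eigenvalue
      ((A j).toLinearMap.restrict (p := L') (q := L') (hinv' j))
    obtain ⟨⟨x, hx⟩, hxν, hx0⟩ := hν.exists_hasEigenvector
    have hxν' : A j x = ν • x := congrArg Subtype.val (Module.End.mem_eigenspace_iff.mp hxν)
    refine ⟨L' ⊓ LinearMap.ker (A j - ν • (1 : E →L[ℂ] E)).toLinearMap, inf_le_left.trans hle,
      ?_, fun i y hy => ⟨hinv' i y hy.1, ?_⟩, fun i hi => ?_⟩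
    · refine (Submodule.ne_bot_iff _).mpr ⟨x, ⟨hx, ?_⟩, fun h => hx0 (Subtype.ext h)⟩
      simp [hxν']
    · have h1 : A j y = ν • y := by simpa [sub_eq_zero] using hy.2
      have h2 : A j (A i y) = A i (A j y) := congrArg (fun T => T y) (hcomm j i).eq
      simp [h2, h1]
    · rcases Finset.mem_insert.mp hi with rfl | hi
      · exact ⟨ν, fun y hy => by simpa [sub_eq_zero] using hy.2⟩
      · obtain ⟨c, hc⟩ := hs i hi
        exact ⟨c, fun y hy => hc y hy.1⟩

variable [CompleteSpace E]

/-- `A j - μ j` is normal, so it has the same kernel as its adjoint. -/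
theorem isReducingVector_of_isStarNormal (hN : ∀ j, IsStarNormal (A j)) {μ : Fin m → ℂ} {x : E}
    (h : ∀ j, A j x = μ j • x) : IsReducingVector A μ x := fun j => by
  refine ⟨h j, ?_⟩
  have hn : IsStarNormal (A j - μ j • (1 : E →L[ℂ] E)) := ⟨by
    rw [star_sub, star_smul, star_one]
    exact Commute.sub_left ((hN j).star_comm_self.sub_right ((Commute.one_right _).smul_right _))
      ((Commute.one_left _).smul_left _)⟩
  have h1 := (ContinuousLinearMap.IsStarNormal.adjoint_apply_eq_zero_iff hn x).mpr (by simp [h j])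
  rw [← ContinuousLinearMap.star_eq_adjoint, star_sub, star_smul, star_one] at h1
  rw [← ContinuousLinearMap.star_eq_adjoint]
  exact sub_eq_zero.mp (by simpa using h1)

/-- The complex coefficients of a real functional on `ℂ^m`. -/
noncomputable def functionalCoeff {m : ℕ} (f : (Fin m → ℂ) →L[ℝ] ℝ) (j : Fin m) : ℂ :=
  f (Pi.single j 1) - Complex.I * f (Pi.single j Complex.I)

theorem re_sum_functionalCoeff_mul (f : (Fin m → ℂ) →L[ℝ] ℝ) (a : Fin m → ℂ) :
    (∑ j, functionalCoeff f j * a j).re = f a := by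
  have ha : a = ∑ j, ((a j).re • (Pi.single j 1 : Fin m → ℂ) +
      (a j).im • (Pi.single j Complex.I : Fin m → ℂ)) := by
    funext i
    simp only [Finset.sum_apply, Pi.add_apply, Pi.smul_apply, Pi.single_apply, Complex.real_smul,
      mul_ite, mul_one, mul_zero, Finset.sum_add_distrib, Finset.sum_ite_eq, Finset.mem_univ,
      if_true, Complex.re_add_im]
  conv_rhs => rw [ha]
  simp only [map_sum, map_add, map_smul, smul_eq_mul, Complex.re_sum]
  refine Finset.sum_congr rfl fun j _ => ?_
  simp [functionalCoeff]
  ring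

/-- The self-adjoint operator representing a real functional of the joint form. -/
noncomputable def functionalOperator {H : Type*} [NormedAddCommGroup H] [InnerProductSpace ℂ H]
    [CompleteSpace H] {m : ℕ} (A : Fin m → H →L[ℂ] H) (f : (Fin m → ℂ) →L[ℝ] ℝ) : H →L[ℂ] H :=
  (2 : ℂ)⁻¹ • (∑ j, functionalCoeff f j • A j +
    ∑ j, (starRingEnd ℂ) (functionalCoeff f j) • ContinuousLinearMap.adjoint (A j))

variable {f : (Fin m → ℂ) →L[ℝ] ℝ}

theorem inner_functionalOperator_left (x y : E) :
    inner ℂ (functionalOperator A f x) y = inner ℂ x (functionalOperator A f y) := by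
  simp only [functionalOperator, smul_apply, add_apply,
    sum_apply, inner_smul_left, inner_smul_right, inner_add_left,
    inner_add_right, sum_inner, inner_sum, ContinuousLinearMap.adjoint_inner_left,
    ContinuousLinearMap.adjoint_inner_right, Complex.conj_conj, map_inv₀, map_ofNat]
  rw [add_comm]

theorem inner_self_functionalOperator (x : E) :
    inner ℂ x (functionalOperator A f x) = (f (jointForm A x) : ℂ) := by
  have h1 : ∑ j, functionalCoeff f j * inner ℂ x (A j x) +
      (starRingEnd ℂ) (∑ j, functionalCoeff f j * inner ℂ x (A j x)) =
      2 * (f (jointForm A x) : ℂ) := by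
    rw [Complex.add_conj, ← re_sum_functionalCoeff_mul f (jointForm A x)]
    simp [jointForm]
  simp only [functionalOperator, smul_apply, add_apply,
    sum_apply, inner_smul_right, inner_add_right, inner_sum,
    ContinuousLinearMap.adjoint_inner_right]
  simp only [map_sum, map_mul, inner_conj_symm] at h1
  rw [h1]
  simp

/-- Commutation with the adjoints is Fuglede's theorem. -/
theorem commute_functionalOperator (hN : ∀ j, IsStarNormal (A j))
    (hcomm : ∀ i j, Commute (A i) (A j)) (i : Fin m) : Commute (A i) (functionalOperator A f) := by
  refine Commute.smul_right (Commute.add_right ?_ ?_) _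
  · exact Commute.sum_right _ _ _ fun j _ => (hcomm i j).smul_right _
  · refine Commute.sum_right _ _ _ fun j _ => Commute.smul_right ?_ _
    rw [← ContinuousLinearMap.star_eq_adjoint]
    exact (hN j).commute_star_right (hcomm i j)

theorem IsReducingVector.inner_functionalOperator_eq_zero {μ : Fin m → ℂ} {x y : E}
    (h : IsReducingVector A μ x) (hxy : inner ℂ x y = 0) :
    inner ℂ x (functionalOperator A f y) = 0 := by
  rw [← inner_functionalOperator_left]
  simp only [functionalOperator, smul_apply, add_apply,
    sum_apply, inner_smul_left, inner_add_left, sum_inner, (h _).1, (h _).2,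
    hxy, mul_zero, Finset.sum_const_zero, add_zero]

/-- A maximizer of the functional on the complement of a family of reducing vectors is an
eigenvector. -/
theorem functionalOperator_apply_eq_of_max {e : Fin n → E} {μ : Fin n → Fin m → ℂ}
    (hμ : ∀ i, IsReducingVector A (μ i) (e i)) {y : E} (hy : ‖y‖ = 1)
    (hey : ∀ i, inner ℂ (e i) y = 0)
    (hmax : ∀ z, (∀ i, inner ℂ (e i) z = 0) →
      f (jointForm A z) ≤ f (jointForm A y) * ‖z‖ ^ 2) :
    functionalOperator A f y = (f (jointForm A y) : ℂ) • y := by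
  set T := functionalOperator A f with hT
  set t := f (jointForm A y) with ht
  set w := T y - (t : ℂ) • y with hw
  have hew : ∀ i, inner ℂ (e i) w = 0 := fun i => by
    rw [hw, inner_sub_right, inner_smul_right, hey, mul_zero, sub_zero]
    exact (hμ i).inner_functionalOperator_eq_zero (hey i)
  have hTy : T y = w + (t : ℂ) • y := by rw [hw, sub_add_cancel]
  have hyy : inner ℂ y y = (1 : ℂ) := by rw [inner_self_eq_ofReal_norm_sq, hy]; simp
  have hyw : inner ℂ y w = 0 := by
    rw [hw, inner_sub_right, inner_smul_right, inner_self_functionalOperator, hyy, mul_one,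
      sub_self]
  have hwy := inner_eq_zero_symm.mp hyw
  -- Maximality along `y + s w`, with `w` the defect of the eigenvalue equation; the linear
  -- coefficient is `2 ‖w‖ ^ 2`.
  have hineq : ∀ s : ℝ, 2 * s * ‖w‖ ^ 2 + s ^ 2 * (f (jointForm A w) - t * ‖w‖ ^ 2) ≤ 0 := by
    intro s
    have h1 := hmax (y + (s : ℂ) • w) fun i => by
      rw [inner_add_right, inner_smul_right, hey, hew, mul_zero, add_zero]
    have h2 : f (jointForm A (y + (s : ℂ) • w)) =
        t + 2 * s * ‖w‖ ^ 2 + s ^ 2 * f (jointForm A w) := by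
      rw [← Complex.ofReal_inj, ← inner_self_functionalOperator, ← hT]
      have h3 : inner ℂ w (T w) = (f (jointForm A w) : ℂ) := inner_self_functionalOperator w
      have h4 : inner ℂ y (T w) = ((‖w‖ ^ 2 : ℝ) : ℂ) := by
        rw [hT, ← inner_functionalOperator_left, ← hT, hTy, inner_add_left, inner_smul_left, hyw,
          mul_zero, add_zero, inner_self_eq_ofReal_norm_sq]
      simp only [map_add, map_smul, inner_add_left, inner_add_right, inner_smul_left,
        inner_smul_right, h3, h4, Complex.conj_ofReal, hTy, hyw, hwy, hyy,
        inner_self_eq_ofReal_norm_sq w]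
      push_cast
      ring
    have h5 : ‖y + (s : ℂ) • w‖ ^ 2 = 1 + s ^ 2 * ‖w‖ ^ 2 := by
      rw [← Complex.ofReal_inj, ← inner_self_eq_ofReal_norm_sq]
      simp only [inner_add_left, inner_add_right, inner_smul_left, inner_smul_right, hyw, hwy,
        hyy, Complex.conj_ofReal, inner_self_eq_ofReal_norm_sq w]
      push_cast
      ring
    rw [h2, h5] at h1
    linarith
  have hw0 : ‖w‖ ^ 2 ≤ 0 := by
    by_contra hpos
    rw [not_le] at hpos
    set c := f (jointForm A w) - t * ‖w‖ ^ 2 with hc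
    -- A step small enough for the linear term to dominate the quadratic one, whatever the sign of
    -- `c`.
    have h1 := hineq (‖w‖ ^ 2 / (|c| + 1))
    have h2 : 0 < |c| + 1 := by positivity
    have h3 : -(|c| + 1) ≤ c := by linarith [neg_abs_le c]
    have h4 : 2 * (‖w‖ ^ 2 / (|c| + 1)) * ‖w‖ ^ 2 + (‖w‖ ^ 2 / (|c| + 1)) ^ 2 * -(|c| + 1) ≤ 0 :=
      le_trans (by gcongr) h1
    have h5 : 2 * (‖w‖ ^ 2 / (|c| + 1)) * ‖w‖ ^ 2 + (‖w‖ ^ 2 / (|c| + 1)) ^ 2 * -(|c| + 1) =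
        ‖w‖ ^ 2 * ‖w‖ ^ 2 / (|c| + 1) := by
      field_simp; ring
    rw [h5] at h4
    exact absurd h4 (not_le.mpr (by positivity))
  have hw1 : ‖w‖ = 0 := by nlinarith [norm_nonneg w]
  exact sub_eq_zero.mp (norm_eq_zero.mp hw1)

/-- A positive maximum of the functional on the complement of a top family is attained at a common
eigenvector. -/
theorem IsTopFamily.exists_reducing_max (hA : ∀ j, IsCompactOperator (A j))
    (hN : ∀ j, IsStarNormal (A j)) (hcomm : ∀ i j, Commute (A i) (A j)) {e : Fin n → E}
    {μ : Fin n → Fin m → ℂ} {t : ℝ} (h : IsTopFamily A f e μ t) {z₀ : E}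
    (hz₀ : ∀ i, inner ℂ (e i) z₀ = 0) (hpos : 0 < f (jointForm A z₀)) :
    ∃ ν y, ‖y‖ = 1 ∧ (∀ i, inner ℂ (e i) y = 0) ∧ IsReducingVector A ν y ∧ 0 < f ν ∧ f ν ≤ t ∧
      ∀ z, (∀ i, inner ℂ (e i) z = 0) → f (jointForm A z) ≤ f ν * ‖z‖ ^ 2 := by
  obtain ⟨y, hy, hey, hy0, hyt, hmax⟩ := h.exists_max hA hz₀ hpos
  set s := f (jointForm A y) with hs
  have hTy := functionalOperator_apply_eq_of_max h.reducing hy hey hmax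
  -- The top eigenspace within the complement: finite-dimensional because `s > 0`, and invariant
  -- under the `A j`, so it contains a common eigenvector, at which `f` has the same maximum.
  let L : Submodule ℂ E := (Submodule.span ℂ (Set.range e))ᗮ ⊓
    LinearMap.ker (functionalOperator A f - (s : ℂ) • (1 : E →L[ℂ] E)).toLinearMap
  have hmem : ∀ x, x ∈ L ↔ (∀ i, inner ℂ (e i) x = 0) ∧
      functionalOperator A f x = (s : ℂ) • x := by
    intro x
    rw [Submodule.mem_inf, Submodule.mem_orthogonal]
    refine and_congr ⟨fun hx i => hx _ (Submodule.subset_span ⟨i, rfl⟩), fun hx u hu => ?_⟩ ?_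
    · obtain ⟨c, rfl⟩ := (Submodule.mem_span_range_iff_exists_fun ℂ).mp hu
      simp [sum_inner, inner_smul_left, hx]
    · simp [sub_eq_zero]
  have hform : ∀ x ∈ L, f (jointForm A x) = s * ‖x‖ ^ 2 := fun x hx => by
    rw [← Complex.ofReal_inj, ← inner_self_functionalOperator, ((hmem x).mp hx).2,
      inner_smul_right, inner_self_eq_ofReal_norm_sq]
    push_cast; rfl
  obtain ⟨N, hfin⟩ := exists_finrank_le_of_jointForm_ge hA f hy0
  have hLfin := (hfin L fun x hx => (hform x hx).ge).1
  have hLne : L ≠ ⊥ := (Submodule.ne_bot_iff _).mpr ⟨y, (hmem y).mpr ⟨hey, hTy⟩, fun h0 => by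
    rw [h0, norm_zero] at hy; exact zero_ne_one hy⟩
  obtain ⟨x, hxL, hx0, ν, hν⟩ := exists_common_eigenvector hcomm hLfin hLne fun j x hx => by
    obtain ⟨hx1, hx2⟩ := (hmem x).mp hx
    refine (hmem _).mpr ⟨fun i => ?_, ?_⟩
    · rw [← ContinuousLinearMap.adjoint_inner_left, (h.reducing i j).2, inner_smul_left, hx1,
        mul_zero]
    · have h1 : A j (functionalOperator A f x) = functionalOperator A f (A j x) :=
        congrArg (fun T => T x) (commute_functionalOperator hN hcomm j).eq
      rw [← h1, hx2, map_smul]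
  have hn : ‖x‖ ≠ 0 := norm_ne_zero_iff.mpr hx0
  have hu : ‖((‖x‖⁻¹ : ℝ) : ℂ) • x‖ = 1 := by rw [norm_smul]; simp [hn]
  have hred := (isReducingVector_of_isStarNormal hN hν).smul ((‖x‖⁻¹ : ℝ) : ℂ)
  have hval : f ν = s := by
    rw [← hred.jointForm_eq hu, hform _ (L.smul_mem _ hxL), hu]
    ring
  refine ⟨ν, _, hu, ((hmem _).mp (L.smul_mem _ hxL)).1, hred, ?_, ?_, ?_⟩
  · rwa [hval]
  · rwa [hval]
  · rwa [hval]

/-- For commuting normal compact operators with a large common kernel, each real functional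
attains its maximum over the joint numerical range at a sum of joint eigenvalues. -/
theorem exists_jointEigenvalueSums_max (hA : ∀ j, IsCompactOperator (A j))
    (hN : ∀ j, IsStarNormal (A j)) (hcomm : ∀ i j, Commute (A i) (A j))
    (hker : ∀ M : Submodule ℂ E, FiniteDimensional ℂ M → ∃ z ∈ Mᗮ, ‖z‖ = 1 ∧ ∀ j, A j z = 0)
    (f : (Fin m → ℂ) →L[ℝ] ℝ) (k : ℕ) :
    ∃ s ∈ jointEigenvalueSums k A, ∀ w ∈ jointNumericalRange k A, f w ≤ f s := by
  have hex : ∀ n, ∃ (e : Fin n → E) (μ : Fin n → Fin m → ℂ) (t : ℝ),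
      0 ≤ t ∧ IsTopFamily A f e μ t := by
    intro n
    induction n with
    | zero =>
      obtain ⟨t, ht, h⟩ := exists_isTopFamily_zero hA f
      exact ⟨_, _, t, ht, h⟩
    | succ n ih =>
      obtain ⟨e, μ, t, ht, h⟩ := ih
      by_cases hpos : ∃ z₀, (∀ i, inner ℂ (e i) z₀ = 0) ∧ 0 < f (jointForm A z₀)
      · obtain ⟨z₀, hz₀, hpos⟩ := hpos
        obtain ⟨ν, y, hy, hey, hred, hν, hνt, hmax⟩ :=
          h.exists_reducing_max hA hN hcomm hz₀ hpos
        exact ⟨_, _, _, hν.le, h.snoc hy hey hred hνt hmax⟩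
      -- Once nothing positive is left, the family is padded with kernel vectors of joint eigenvalue
      -- `0`; this is where `0 ≤ t` is needed.
      · push Not at hpos
        obtain ⟨z, hzM, hz, hAz⟩ := hker (Submodule.span ℂ (Set.range e))
          (FiniteDimensional.span_of_finite ℂ (Set.finite_range e))
        have hred : IsReducingVector A 0 z :=
          isReducingVector_of_isStarNormal hN fun j => by simp [hAz]
        have h0 : f 0 = 0 := map_zero f
        refine ⟨_, _, _, h0.ge, h.snoc hz (fun i => hzM _ (Submodule.subset_span ⟨i, rfl⟩)) hred
          (h0.trans_le ht) fun y hy => ?_⟩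
        rw [h0, zero_mul]
        exact hpos y hy
  obtain ⟨e, μ, t, -, h⟩ := hex k
  refine ⟨∑ l, μ l, ⟨μ, e, h.orthonormal.linearIndependent, fun l =>
    ⟨h.orthonormal.ne_zero l, fun j => (h.reducing l j).1⟩, rfl⟩, fun w hw => ?_⟩
  obtain ⟨x, hx, rfl⟩ := mem_jointNumericalRange_iff.mp hw
  have h1 := h.sum_le hx
  rw [sub_self, zero_mul, add_zero] at h1
  rwa [map_sum f μ]

end CommutingNormal

/-! ### The Schur–Horn theorem for projections, by two-coordinate rotations. -/

section SchurHorn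

variable {ι : Type*} [Fintype ι] [DecidableEq ι] {k : ℕ}

theorem Fintype.sum_eq_sum_of_eq_off_pair {M : Type*} [AddCommMonoid M] {F G : ι → M} {a b : ι}
    (hab : a ≠ b) (h : F a + F b = G a + G b) (hoff : ∀ i, i ≠ a → i ≠ b → F i = G i) :
    ∑ i, F i = ∑ i, G i := by
  have hb : b ∈ Finset.univ.erase a := Finset.mem_erase.mpr ⟨hab.symm, Finset.mem_univ b⟩
  rw [← Finset.add_sum_erase _ F (Finset.mem_univ a), ← Finset.add_sum_erase _ F hb,
    ← Finset.add_sum_erase _ G (Finset.mem_univ a), ← Finset.add_sum_erase _ G hb, ← add_assoc,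
    ← add_assoc, h]
  congr 1
  refine Finset.sum_congr rfl fun i hi => ?_
  simp only [Finset.mem_erase] at hi
  exact hoff i hi.2.1 hi.1

theorem Complex.exists_norm_eq_one_re_mul_eq_zero (g : ℂ) : ∃ ω : ℂ, ‖ω‖ = 1 ∧ (ω * g).re = 0 := by
  rcases eq_or_ne g 0 with rfl | hg
  · exact ⟨1, by simp⟩
  · have hn : ‖g‖ ≠ 0 := norm_ne_zero_iff.mpr hg
    refine ⟨Complex.I * (starRingEnd ℂ) g / ‖g‖, by simp [hn], ?_⟩
    have h1 : Complex.I * (starRingEnd ℂ) g / ‖g‖ * g = Complex.I * (‖g‖ : ℂ) := by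
      have h2 := conj_mul_self_eq_ofReal g
      have h3 : (‖g‖ : ℂ) ≠ 0 := by exact_mod_cast hn
      field_simp
      rw [h2]
      push_cast; rfl
    rw [h1]
    simp

theorem Complex.norm_add_sq' (z w : ℂ) :
    ‖z + w‖ ^ 2 = ‖z‖ ^ 2 + ‖w‖ ^ 2 + 2 * ((starRingEnd ℂ) z * w).re := by
  rw [← Complex.normSq_eq_norm_sq, ← Complex.normSq_eq_norm_sq, ← Complex.normSq_eq_norm_sq,
    Complex.normSq_add, ← Complex.conj_re (z * (starRingEnd ℂ) w)]
  simp

/-- Rotating two coordinates realizes a transfer between two diagonal entries. -/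
theorem exists_orthonormal_rows_transfer {x : Fin k → ι → ℂ} {q : ι → ℝ}
    (hx : ∀ l l', ∑ i, (starRingEnd ℂ) (x l i) * x l' i = if l = l' then 1 else 0)
    (hq : ∀ i, ∑ l, ‖x l i‖ ^ 2 = q i) {a b : ι} (hab : a ≠ b) {τ : ℝ} (hτ0 : 0 ≤ τ)
    (hτ1 : τ ≤ 1) {p : ι → ℝ} (hpa : p a = τ * q a + (1 - τ) * q b)
    (hpb : p b = (1 - τ) * q a + τ * q b) (hp : ∀ i, i ≠ a → i ≠ b → p i = q i) :
    ∃ x' : Fin k → ι → ℂ,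
      (∀ l l', ∑ i, (starRingEnd ℂ) (x' l i) * x' l' i = if l = l' then 1 else 0) ∧
      ∀ i, ∑ l, ‖x' l i‖ ^ 2 = p i := by
  -- The phase makes the cross term purely imaginary, so the rotation averages the two diagonal
  -- entries exactly.
  obtain ⟨ω, hω, hωg⟩ :=
    Complex.exists_norm_eq_one_re_mul_eq_zero (∑ l, (starRingEnd ℂ) (x l a) * x l b)
  have hωω : (starRingEnd ℂ) ω * ω = 1 := by rw [conj_mul_self_eq_ofReal, hω]; simp
  have hc : √τ ^ 2 = τ := Real.sq_sqrt hτ0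
  have hs : √(1 - τ) ^ 2 = 1 - τ := Real.sq_sqrt (by linarith)
  set c := √τ
  set s := √(1 - τ)
  have hcs : (c : ℂ) ^ 2 + (s : ℂ) ^ 2 = 1 := by
    have : c ^ 2 + s ^ 2 = 1 := by rw [hc, hs]; ring
    exact_mod_cast this
  have hcross : ∑ l, (ω * ((starRingEnd ℂ) (x l a) * x l b)).re = 0 := by
    rw [← Complex.re_sum, ← Finset.mul_sum, hωg]
  let x' : Fin k → ι → ℂ := fun l i => if i = a then c * x l a + s * (ω * x l b)
    else if i = b then -(s * ((starRingEnd ℂ) ω * x l a)) + c * x l b else x l i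
  have hxa : ∀ l, x' l a = c * x l a + s * (ω * x l b) := fun l => if_pos rfl
  have hxb : ∀ l, x' l b = -(s * ((starRingEnd ℂ) ω * x l a)) + c * x l b := fun l => by
    simp [x', hab.symm]
  have hxo : ∀ l i, i ≠ a → i ≠ b → x' l i = x l i := fun l i hia hib => by simp [x', hia, hib]
  refine ⟨x', fun l l' => ?_, fun i => ?_⟩
  · rw [← hx l l']
    refine Fintype.sum_eq_sum_of_eq_off_pair hab ?_ fun i hia hib => by
      rw [hxo l i hia hib, hxo l' i hia hib]
    rw [hxa, hxa, hxb, hxb]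
    simp only [map_add, map_mul, map_neg, Complex.conj_ofReal, Complex.conj_conj]
    linear_combination ((starRingEnd ℂ) (x l a) * x l' a + (starRingEnd ℂ) (x l b) * x l' b) * hcs +
      (s : ℂ) ^ 2 * ((starRingEnd ℂ) (x l a) * x l' a + (starRingEnd ℂ) (x l b) * x l' b) * hωω
  · by_cases hia : i = a
    · subst hia
      have h1 : ∀ l, ‖x' l i‖ ^ 2 = τ * ‖x l i‖ ^ 2 + (1 - τ) * ‖x l b‖ ^ 2 +
          2 * c * s * (ω * ((starRingEnd ℂ) (x l i) * x l b)).re := fun l => by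
        rw [hxa, Complex.norm_add_sq', norm_mul, norm_mul, norm_mul, hω, mul_pow, mul_pow,
          Complex.norm_real, Complex.norm_real, Real.norm_eq_abs, Real.norm_eq_abs, sq_abs,
          sq_abs, hc, hs, map_mul, Complex.conj_ofReal,
          show (c : ℂ) * (starRingEnd ℂ) (x l i) * (s * (ω * x l b)) =
            ((c * s : ℝ) : ℂ) * (ω * ((starRingEnd ℂ) (x l i) * x l b)) by push_cast; ring,
          Complex.re_ofReal_mul]
        ring
      simp only [h1, Finset.sum_add_distrib, ← Finset.mul_sum, hq, hcross, hpa]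
      ring
    · by_cases hib : i = b
      · subst hib
        have h1 : ∀ l, ‖x' l i‖ ^ 2 = (1 - τ) * ‖x l a‖ ^ 2 + τ * ‖x l i‖ ^ 2 -
            2 * c * s * (ω * ((starRingEnd ℂ) (x l a) * x l i)).re := fun l => by
          rw [hxb, Complex.norm_add_sq']
          simp only [norm_neg, norm_mul, Complex.norm_conj, hω, mul_pow, Complex.norm_real,
            Real.norm_eq_abs, sq_abs, hc, hs]
          rw [map_neg, map_mul, map_mul, Complex.conj_conj, Complex.conj_ofReal,
            show -((s : ℂ) * (ω * (starRingEnd ℂ) (x l a))) * (c * x l i) =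
              ((-(c * s) : ℝ) : ℂ) * (ω * ((starRingEnd ℂ) (x l a) * x l i)) by push_cast; ring,
            Complex.re_ofReal_mul]
          ring
        simp only [h1, Finset.sum_add_distrib, Finset.sum_sub_distrib, ← Finset.mul_sum, hq,
          hcross, hpb]
        ring
      · simp only [hxo _ i hia hib, hq, hp i hia hib]

/-- The Schur–Horn theorem for projections: a vector with entries in `[0, 1]` and sum `k` is the
diagonal of a projection of rank `k`. -/
theorem exists_orthonormal_rows_of_sum_eq (p : ι → ℝ) (h0 : ∀ i, 0 ≤ p i) (h1 : ∀ i, p i ≤ 1)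
    (hsum : ∑ i, p i = k) :
    ∃ x : Fin k → ι → ℂ,
      (∀ l l', ∑ i, (starRingEnd ℂ) (x l i) * x l' i = if l = l' then 1 else 0) ∧
      ∀ i, ∑ l, ‖x l i‖ ^ 2 = p i := by
  -- Induction on the number of entries strictly between `0` and `1`.
  induction hN : (Finset.univ.filter fun i => p i ≠ 0 ∧ p i ≠ 1).card using
    Nat.strong_induction_on generalizing p with
  | _ N ih =>
  by_cases hfrac : ∃ a, p a ≠ 0 ∧ p a ≠ 1
  · obtain ⟨a, ha0, ha1⟩ := hfrac
    -- A single fractional entry is impossible, as the sum is an integer.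
    have hex : ∃ b, b ≠ a ∧ p b ≠ 0 ∧ p b ≠ 1 := by
      by_contra hnone
      push Not at hnone
      have hint : ∑ i ∈ Finset.univ.erase a, p i =
          (((Finset.univ.erase a).filter fun i => p i = 1).card : ℝ) := by
        rw [Finset.card_filter, Nat.cast_sum]
        refine Finset.sum_congr rfl fun i hi => ?_
        by_cases hi0 : p i = 0
        · simp [hi0]
        · simp [hnone i (Finset.ne_of_mem_erase hi) hi0]
      rw [← Finset.add_sum_erase _ _ (Finset.mem_univ a), hint] at hsum
      have hlt0 := lt_of_le_of_ne (h0 a) (Ne.symm ha0)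
      have hlt1 := lt_of_le_of_ne (h1 a) ha1
      set r := ((Finset.univ.erase a).filter fun i => p i = 1).card
      have h2 : (r : ℝ) < k := by linarith
      have h3 : (k : ℝ) < r + 1 := by linarith
      have h2' : r < k := by exact_mod_cast h2
      have h3' : k < r + 1 := by exact_mod_cast h3
      omega
    obtain ⟨b, hba, hb0, hb1⟩ := hex
    have hpa := lt_of_le_of_ne (h0 a) (Ne.symm ha0)
    have hpa1 := lt_of_le_of_ne (h1 a) ha1
    have hpb := lt_of_le_of_ne (h0 b) (Ne.symm hb0)
    have hpb1 := lt_of_le_of_ne (h1 b) hb1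
    -- The pair `(p a, p b)` is spread to `(r, t)` with the same sum, one of them now `0` or `1`; a
    -- transfer with parameter `τ` recovers `p`.
    have key : ∀ r t : ℝ, 0 ≤ r → r ≤ 1 → 0 ≤ t → t ≤ 1 → r + t = p a + p b →
        (t = 0 ∨ r = 1) → ∀ τ : ℝ, 0 ≤ τ → τ ≤ 1 → p a = τ * r + (1 - τ) * t →
        ∃ x : Fin k → ι → ℂ,
          (∀ l l', ∑ i, (starRingEnd ℂ) (x l i) * x l' i = if l = l' then 1 else 0) ∧
          ∀ i, ∑ l, ‖x l i‖ ^ 2 = p i := by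
      intro r t hr0 hr1 ht0 ht1 hrt hor τ hτ0 hτ1 hτ
      let q : ι → ℝ := fun i => if i = a then r else if i = b then t else p i
      have hqa : q a = r := if_pos rfl
      have hqb : q b = t := by simp [q, hba]
      have hqo : ∀ i, i ≠ a → i ≠ b → q i = p i := fun i hia hib => by simp [q, hia, hib]
      have hcases : ∀ P : ι → Prop, P a → P b → (∀ i, i ≠ a → i ≠ b → P i) → ∀ i, P i := by
        intro P hPa hPb hPo i
        by_cases hia : i = a
        · exact hia ▸ hPa
        · by_cases hib : i = b
          · exact hib ▸ hPb
          · exact hPo i hia hib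
      have hcard : (Finset.univ.filter fun i => q i ≠ 0 ∧ q i ≠ 1).card < N := by
        rw [← hN]
        refine Finset.card_lt_card (Finset.ssubset_iff_subset_ne.mpr ⟨fun i => ?_, fun heq => ?_⟩)
        · simp only [Finset.mem_filter, Finset.mem_univ, true_and]
          revert i
          exact hcases _ (fun _ => ⟨ha0, ha1⟩) (fun _ => ⟨hb0, hb1⟩)
            fun i hia hib h => hqo i hia hib ▸ h
        · have hma : a ∈ Finset.univ.filter fun i => q i ≠ 0 ∧ q i ≠ 1 := heq ▸ by simp [ha0, ha1]
          have hmb : b ∈ Finset.univ.filter fun i => q i ≠ 0 ∧ q i ≠ 1 := heq ▸ by simp [hb0, hb1]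
          simp only [Finset.mem_filter, Finset.mem_univ, true_and, hqa, hqb] at hma hmb
          exact hor.elim hmb.1 hma.2
      obtain ⟨x, hx, hxq⟩ := ih _ hcard q
        (hcases _ (hqa ▸ hr0) (hqb ▸ ht0) fun i hia hib => hqo i hia hib ▸ h0 i)
        (hcases _ (hqa ▸ hr1) (hqb ▸ ht1) fun i hia hib => hqo i hia hib ▸ h1 i)
        (by
          rw [← hsum]
          exact Fintype.sum_eq_sum_of_eq_off_pair hba.symm (by rw [hqa, hqb, hrt]) hqo) rfl
      refine exists_orthonormal_rows_transfer hx hxq hba.symm hτ0 hτ1 ?_ ?_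
        fun i hia hib => (hqo i hia hib).symm
      · rw [hqa, hqb, hτ]
      · rw [hqa, hqb]
        linarith
    rcases le_total (p a + p b) 1 with hle | hle
    · have hpos : 0 < p a + p b := by linarith
      refine key (p a + p b) 0 hpos.le hle le_rfl zero_le_one (by ring) (Or.inl rfl)
        (p a / (p a + p b)) (by positivity) (div_le_one_of_le₀ (by linarith) hpos.le) ?_
      field_simp
      ring
    · have hpos : 0 < 2 - p a - p b := by linarith
      refine key 1 (p a + p b - 1) zero_le_one le_rfl (by linarith) (by linarith) (by ring)
        (Or.inr rfl) ((1 - p b) / (2 - p a - p b)) (div_nonneg (by linarith) hpos.le)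
        (div_le_one_of_le₀ (by linarith) hpos.le) ?_
      field_simp
      ring
  · push Not at hfrac
    have h01 : ∀ i, p i = if p i = 1 then 1 else 0 := fun i => by
      by_cases hi : p i = 1
      · simp [hi]
      · rw [if_neg hi]
        by_contra hi0
        exact hi (hfrac i hi0)
    have hcard : (Finset.univ.filter fun i => p i = 1).card = k := by
      rw [Finset.sum_congr rfl fun i _ => h01 i, Finset.sum_boole] at hsum
      exact_mod_cast hsum
    let g := (Finset.equivFinOfCardEq hcard).symm
    refine ⟨fun l i => if i = g l then 1 else 0, fun l l' => ?_, fun i => ?_⟩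
    · simp [eq_comm]
    · rw [h01 i]
      by_cases hi : p i = 1
      · have hmem : i ∈ Finset.univ.filter fun i => p i = 1 := by simp [hi]
        have h2 : ∀ l, i = g l ↔ l = g.symm ⟨i, hmem⟩ := fun l => by
          rw [Equiv.eq_symm_apply, Subtype.ext_iff, eq_comm]
        simp [h2, hi, apply_ite]
      · have h2 : ∀ l, i ≠ g l := fun l h => hi (by
          have := (Finset.mem_filter.mp (g l).2).2
          rwa [← h] at this)
        simp [h2, hi]

end SchurHorn

/-! ### Convexity of the range over the span of the reducing vectors. -/

section Convexity

variable {E : Type*} [NormedAddCommGroup E] [InnerProductSpace ℂ E] {m k : ℕ}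
  {A : Fin m → E →L[ℂ] E} {ι : Type*} [Fintype ι] {e : ι → E} {μ : ι → Fin m → ℂ}

theorem Orthonormal.eq_sum_inner_smul_of_mem_span (he : Orthonormal ℂ e) {x : E}
    (hx : x ∈ Submodule.span ℂ (Set.range e)) : x = ∑ i, inner ℂ (e i) x • e i := by
  obtain ⟨c, rfl⟩ := (Submodule.mem_span_range_iff_exists_fun ℂ).mp hx
  simp only [he.inner_right_fintype]

/-- Weights with entries in `[0, 1]` and sum `k`. -/
def IsWeight {ι : Type*} [Fintype ι] (k : ℕ) (p : ι → ℝ) : Prop :=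
  (∀ i, 0 ≤ p i) ∧ (∀ i, p i ≤ 1) ∧ ∑ i, p i = k

theorem exists_isWeight_of_orthonormal (he : Orthonormal ℂ e)
    (hμ : ∀ i j, A j (e i) = μ i j • e i) {x : Fin k → E} (hx : Orthonormal ℂ x)
    (hxe : ∀ l, x l ∈ Submodule.span ℂ (Set.range e)) :
    ∃ p : ι → ℝ, IsWeight k p ∧ ∑ l, jointForm A (x l) = ∑ i, p i • μ i := by
  refine ⟨fun i => ∑ l, ‖inner ℂ (e i) (x l)‖ ^ 2, ⟨fun i => by positivity, fun i => ?_, ?_⟩, ?_⟩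
  · have h3 := hx.sum_inner_products_le (e i) (s := Finset.univ)
    rw [he.1 i, one_pow] at h3
    simpa only [norm_inner_symm] using h3
  · rw [Finset.sum_comm]
    have h1 : ∀ l, ∑ i, ‖inner ℂ (e i) (x l)‖ ^ 2 = 1 := fun l => by
      have h2 := norm_sub_sum_sq he (x l)
      rw [← he.eq_sum_inner_smul_of_mem_span (hxe l), sub_self, hx.1 l, norm_zero] at h2
      linarith
    simp [h1]
  · have h1 : ∀ l, jointForm A (x l) = ∑ i, (‖inner ℂ (e i) (x l)‖ ^ 2) • μ i := fun l => by
      rw [he.eq_sum_inner_smul_of_mem_span (hxe l), jointForm_sum_smul he hμ,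
        ← he.eq_sum_inner_smul_of_mem_span (hxe l)]
    simp only [h1]
    rw [Finset.sum_comm]
    simp only [Finset.sum_smul]

theorem exists_orthonormal_of_isWeight (he : Orthonormal ℂ e)
    (hμ : ∀ i j, A j (e i) = μ i j • e i) {p : ι → ℝ} (hp : IsWeight k p) :
    ∃ x : Fin k → E, Orthonormal ℂ x ∧ (∀ l, x l ∈ Submodule.span ℂ (Set.range e)) ∧
      ∑ l, jointForm A (x l) = ∑ i, p i • μ i := by
  classical
  obtain ⟨x, hx, hxp⟩ := exists_orthonormal_rows_of_sum_eq p hp.1 hp.2.1 hp.2.2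
  refine ⟨fun l => ∑ i, x l i • e i, ?_, fun l => Submodule.sum_mem _ fun i _ =>
    Submodule.smul_mem _ _ (Submodule.subset_span ⟨i, rfl⟩), ?_⟩
  · rw [orthonormal_iff_ite]
    intro l l'
    rw [he.inner_sum, hx]
  · simp only [jointForm_sum_smul he hμ]
    rw [Finset.sum_comm]
    simp only [← Finset.sum_smul, hxp]

variable [CompleteSpace E]

theorem IsReducingVector.eq_of_inner_ne_zero {ν ν' : Fin m → ℂ} {x y : E}
    (hx : IsReducingVector A ν x) (hy : IsReducingVector A ν' y) (hxy : inner ℂ x y ≠ 0) :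
    ν = ν' := by
  funext j
  have h1 : inner ℂ x (A j y) = inner ℂ (ContinuousLinearMap.adjoint (A j) x) y :=
    (ContinuousLinearMap.adjoint_inner_left _ _ _).symm
  rw [(hy j).1, (hx j).2, inner_smul_right, inner_smul_left, Complex.conj_conj] at h1
  exact (mul_right_cancel₀ hxy h1).symm

theorem isReducingVector_zero (ν : Fin m → ℂ) : IsReducingVector A ν 0 := fun j => by simp

theorem IsReducingVector.sub {ν : Fin m → ℂ} {x y : E} (hx : IsReducingVector A ν x)
    (hy : IsReducingVector A ν y) : IsReducingVector A ν (x - y) := fun j => by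
  simp [(hx j).1, (hx j).2, (hy j).1, (hy j).2, smul_sub]

theorem IsReducingVector.sum {κ : Type*} {s : Finset κ} {ν : Fin m → ℂ} {x : κ → E}
    (hx : ∀ i ∈ s, IsReducingVector A ν (x i)) : IsReducingVector A ν (∑ i ∈ s, x i) := fun j => by
  rw [map_sum, map_sum, Finset.smul_sum, Finset.smul_sum]
  exact ⟨Finset.sum_congr rfl fun i hi => (hx i hi j).1,
    Finset.sum_congr rfl fun i hi => (hx i hi j).2⟩

/-- Gram–Schmidt orthogonalization preserves reducing vectors and their joint eigenvalues. -/
theorem isReducingVector_gramSchmidt {n : ℕ} {x : Fin n → E} {ν : Fin n → Fin m → ℂ}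
    (hx : ∀ i, IsReducingVector A (ν i) (x i)) (i : Fin n) :
    IsReducingVector A (ν i) (InnerProductSpace.gramSchmidt ℂ x i) := by
  induction i using WellFoundedLT.induction with
  | _ i ih =>
  rw [InnerProductSpace.gramSchmidt_def]
  refine (hx i).sub (IsReducingVector.sum fun l hl => ?_)
  rw [Submodule.starProjection_singleton]
  -- A nonzero overlap forces equal joint eigenvalues, so every subtracted projection is reducing
  -- for the same eigenvalue.
  by_cases h0 : inner ℂ (InnerProductSpace.gramSchmidt ℂ x l) (x i) = 0
  · rw [h0, zero_div, zero_smul]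
    exact isReducingVector_zero _
  · have h1 := ih l (Finset.mem_Iio.mp hl)
    rw [← h1.eq_of_inner_ne_zero (hx i) h0]
    exact h1.smul _

theorem isReducingVector_gramSchmidtNormed {n : ℕ} {x : Fin n → E} {ν : Fin n → Fin m → ℂ}
    (hx : ∀ i, IsReducingVector A (ν i) (x i)) (i : Fin n) :
    IsReducingVector A (ν i) (InnerProductSpace.gramSchmidtNormed ℂ x i) :=
  (isReducingVector_gramSchmidt hx i).smul _

/-- The set of all reducing vectors. -/
def reducingVectors {H : Type*} [NormedAddCommGroup H] [InnerProductSpace ℂ H] [CompleteSpace H]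
    {m : ℕ} (A : Fin m → H →L[ℂ] H) : Set H := {x | ∃ ν, IsReducingVector A ν x}

/-- The part of the joint numerical range coming from the span of the reducing vectors. -/
def reducingRange {H : Type*} [NormedAddCommGroup H] [InnerProductSpace ℂ H] [CompleteSpace H]
    {m : ℕ} (k : ℕ) (A : Fin m → H →L[ℂ] H) : Set (Fin m → ℂ) :=
  {a | ∃ x : Fin k → H, Orthonormal ℂ x ∧
    (∀ l, x l ∈ Submodule.span ℂ (reducingVectors A)) ∧ a = ∑ l, jointForm A (x l)}

theorem exists_orthonormal_reducing_of_finite {n : ℕ} {v : Fin n → E} {ν : Fin n → Fin m → ℂ}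
    (hν : ∀ i, IsReducingVector A (ν i) (v i)) :
    ∃ (N : ℕ) (e : Fin N → E) (ν' : Fin N → Fin m → ℂ), Orthonormal ℂ e ∧
      (∀ i, IsReducingVector A (ν' i) (e i)) ∧
      Submodule.span ℂ (Set.range v) ≤ Submodule.span ℂ (Set.range e) := by
  obtain ⟨N, ⟨g⟩⟩ := Finite.exists_equiv_fin {i | InnerProductSpace.gramSchmidtNormed ℂ v i ≠ 0}
  refine ⟨N, fun i => InnerProductSpace.gramSchmidtNormed ℂ v (g.symm i), fun i => ν (g.symm i),
    (InnerProductSpace.gramSchmidtNormed_orthonormal' v).comp g.symm g.symm.injective,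
    fun i => isReducingVector_gramSchmidtNormed hν _, ?_⟩
  rw [← InnerProductSpace.span_gramSchmidt, ← InnerProductSpace.span_gramSchmidtNormed_range,
    Submodule.span_le]
  rintro - ⟨i, rfl⟩
  by_cases hi : InnerProductSpace.gramSchmidtNormed ℂ v i = 0
  · rw [hi]; exact Submodule.zero_mem _
  · exact Submodule.subset_span ⟨g ⟨i, hi⟩, by simp⟩

/-- Finitely many vectors in the span of the reducing vectors lie in the span of a finite
orthonormal family of reducing vectors. -/
theorem exists_orthonormal_reducing_span {T : Set E} (hT : T.Finite)
    (hsub : T ⊆ Submodule.span ℂ (reducingVectors A)) :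
    ∃ (N : ℕ) (e : Fin N → E) (ν : Fin N → Fin m → ℂ), Orthonormal ℂ e ∧
      (∀ i, IsReducingVector A (ν i) (e i)) ∧ T ⊆ Submodule.span ℂ (Set.range e) := by
  classical
  choose g hg hg' using fun x : T => Submodule.mem_span_finite_of_mem_span (hsub x.2)
  have := hT.fintype
  obtain ⟨G, hG⟩ : ∃ G : Finset E, G = Finset.univ.biUnion g := ⟨_, rfl⟩
  have hGred : ∀ x ∈ G, ∃ ν, IsReducingVector A ν x := fun x hx => by
    obtain ⟨y, -, hy⟩ := Finset.mem_biUnion.mp (hG ▸ hx)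
    exact hg y hy
  choose ν hν using fun i => hGred _ (G.equivFin.symm i).2
  obtain ⟨N, e, ν', he, hν', hle⟩ := exists_orthonormal_reducing_of_finite hν
  refine ⟨N, e, ν', he, hν', fun x hx => hle ?_⟩
  refine Submodule.span_mono (fun y hy => ?_) (hg' ⟨x, hx⟩)
  have hyG : y ∈ G := hG ▸ Finset.mem_biUnion.mpr ⟨_, Finset.mem_univ _, hy⟩
  exact ⟨G.equivFin ⟨y, hyG⟩, by simp⟩

/-- Two families lie in the span of one finite orthonormal reducing family, where the range consists
of the weighted sums `∑ i, p i • μ i` with `IsWeight k p`. Weights form a convex set, and Schur–Horn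
realizes each of them. -/
theorem convex_reducingRange : Convex ℝ (reducingRange k A) := by
  rintro - ⟨x, hx, hxs, rfl⟩ - ⟨y, hy, hys, rfl⟩ a b ha hb hab
  obtain ⟨N, e, ν, he, hν, hT⟩ := exists_orthonormal_reducing_span (A := A)
    ((Set.finite_range x).union (Set.finite_range y))
    (Set.union_subset (Set.range_subset_iff.mpr hxs) (Set.range_subset_iff.mpr hys))
  have heig : ∀ i j, A j (e i) = ν i j • e i := fun i j => (hν i j).1
  obtain ⟨p, hp, hpx⟩ := exists_isWeight_of_orthonormal he heig hx
    fun l => hT (Or.inl ⟨l, rfl⟩)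
  obtain ⟨q, hq, hqy⟩ := exists_isWeight_of_orthonormal he heig hy
    fun l => hT (Or.inr ⟨l, rfl⟩)
  obtain ⟨z, hz, hze, hzs⟩ := exists_orthonormal_of_isWeight (k := k)
    (p := fun i => a * p i + b * q i) he heig
    ⟨fun i => add_nonneg (mul_nonneg ha (hp.1 i)) (mul_nonneg hb (hq.1 i)),
      fun i => (add_le_add (mul_le_mul_of_nonneg_left (hp.2.1 i) ha)
        (mul_le_mul_of_nonneg_left (hq.2.1 i) hb)).trans_eq (by rw [mul_one, mul_one, hab]), by
      rw [Finset.sum_add_distrib, ← Finset.mul_sum, ← Finset.mul_sum, hp.2.2, hq.2.2, ← add_mul,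
        hab, one_mul]⟩
  refine ⟨z, hz, fun l => Submodule.span_mono ?_ (hze l), ?_⟩
  · rintro - ⟨i, rfl⟩
    exact ⟨_, hν i⟩
  · rw [hpx, hqy, hzs, Finset.smul_sum, Finset.smul_sum, ← Finset.sum_add_distrib]
    simp only [add_smul, mul_smul]

/-- Gram–Schmidt makes the independent eigenvectors orthonormal without changing their eigenvalues.
-/
theorem jointEigenvalueSums_subset_reducingRange (hN : ∀ j, IsStarNormal (A j)) :
    jointEigenvalueSums k A ⊆ reducingRange k A := by
  rintro - ⟨ν, x, hli, hx, rfl⟩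
  have hred := isReducingVector_gramSchmidtNormed
    fun l => isReducingVector_of_isStarNormal hN (hx l).2
  have hort := InnerProductSpace.gramSchmidtNormed_orthonormal hli
  exact ⟨_, hort, fun l => Submodule.subset_span ⟨_, hred l⟩,
    Finset.sum_congr rfl fun l _ => ((hred l).jointForm_eq (hort.1 l)).symm⟩

theorem convexHull_jointEigenvalueSums_subset (hN : ∀ j, IsStarNormal (A j)) :
    convexHull ℝ (jointEigenvalueSums k A) ⊆ jointNumericalRange k A := by
  refine (convexHull_min (jointEigenvalueSums_subset_reducingRange hN)
    convex_reducingRange).trans ?_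
  rintro a ⟨x, hx, -, ha⟩
  exact mem_jointNumericalRange_iff.mpr ⟨x, hx, ha⟩

end Convexity

/-! ### Recovering a polytope from the maximizers of functionals. -/

section SupportFunctionals

variable {V : Type*} [NormedAddCommGroup V] [NormedSpace ℝ V] {S W : Set V}

/-- If every functional is maximized over `W` at a point of `S`, then `W` lies in the convex hull
of `S` as soon as the latter is closed. -/
theorem subset_convexHull_of_forall_exists_max (hS : IsClosed (convexHull ℝ S))
    (hmax : ∀ f : V →L[ℝ] ℝ, ∃ s ∈ S, ∀ w ∈ W, f w ≤ f s) : W ⊆ convexHull ℝ S := by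
  intro w hw
  by_contra hnot
  obtain ⟨f, u, hlt, hu⟩ := geometric_hahn_banach_closed_point (convex_convexHull ℝ S) hS hnot
  obtain ⟨s, hs, hle⟩ := hmax f
  linarith [hlt s (subset_convexHull ℝ S hs), hle w hw]

/-- If every functional is maximized over `W` at a point of `S ⊆ W` and `conv W` is a polytope,
then `S` contains the vertices of this polytope. -/
theorem convexHull_eq_of_forall_exists_max (hSW : S ⊆ W)
    (hmax : ∀ f : V →L[ℝ] ℝ, ∃ s ∈ S, ∀ w ∈ W, f w ≤ f s) {F : Set V} (hF : F.Finite)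
    (hWF : convexHull ℝ W = convexHull ℝ F) : convexHull ℝ S = convexHull ℝ W := by
  refine (convexHull_mono hSW).antisymm ?_
  let 𝒢 : Set (Set V) := {G | G ⊆ F ∧ convexHull ℝ G = convexHull ℝ F}
  have h𝒢 : 𝒢.Finite := hF.finite_subsets.subset fun G hG => hG.1
  -- Each point `v` of a minimal generating set is exposed by some functional, and the maximizer in
  -- `S` of that functional can only be `v`.
  obtain ⟨G, hG, hmin⟩ := h𝒢.exists_minimal ⟨F, subset_rfl, rfl⟩
  have hGfin : G.Finite := hF.subset hG.1
  rw [hWF, ← hG.2]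
  refine convexHull_min (fun v hv => ?_) (convex_convexHull ℝ S)
  have hvnot : v ∉ convexHull ℝ (G \ {v}) := by
    intro hmem
    have hsub : G ⊆ convexHull ℝ (G \ {v}) := by
      intro p hp
      rcases eq_or_ne p v with rfl | hpv
      · exact hmem
      · exact subset_convexHull ℝ _ ⟨hp, hpv⟩
    have hin : G \ {v} ∈ 𝒢 := ⟨Set.sdiff_subset.trans hG.1,
      ((convexHull_mono Set.sdiff_subset).antisymm
        (convexHull_min hsub (convex_convexHull ℝ _))).trans hG.2⟩
    exact (hmin hin Set.sdiff_subset hv).2 rfl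
  obtain ⟨f, u, hlt, hu⟩ := geometric_hahn_banach_closed_point (convex_convexHull ℝ _)
    ((hGfin.subset Set.sdiff_subset).isClosed_convexHull ℝ) hvnot
  have hstrict : ∀ p ∈ G, p ≠ v → f p < f v := fun p hp hpv =>
    (hlt p (subset_convexHull ℝ _ ⟨hp, hpv⟩)).trans hu
  obtain ⟨C, hC⟩ := exists_norm_sub_le_of_strict_max hGfin hstrict
  obtain ⟨s, hs, hle⟩ := hmax f
  have hconvG : convexHull ℝ W = convexHull ℝ G := hWF.trans hG.2.symm
  have hsG : s ∈ convexHull ℝ G := hconvG ▸ subset_convexHull ℝ W (hSW hs)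
  have hvs : f v ≤ f s := convexHull_min (t := {w | f w ≤ f s}) hle
    (convex_halfSpace_le f.isLinear _) (hconvG ▸ subset_convexHull ℝ G hv)
  have hsv : f s ≤ f v := convexHull_min (t := {w | f w ≤ f v})
    (fun p hp => by
      rcases eq_or_ne p v with rfl | hpv
      · exact le_refl (f p)
      · exact (hstrict p hp hpv).le) (convex_halfSpace_le f.isLinear _) hsG
  have h1 := hC s hsG
  rw [le_antisymm hvs hsv, sub_self, mul_zero] at h1
  rw [← sub_eq_zero.mp (norm_le_zero_iff.mp h1)]
  exact subset_convexHull ℝ S hs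

end SupportFunctionals

/-! ### Stability of the hypotheses under adding a zero summand. -/

section DirectSum

variable {H : Type*} [NormedAddCommGroup H] [InnerProductSpace ℂ H]
  {K : Type*} [NormedAddCommGroup K] [InnerProductSpace ℂ K]

theorem oplusZero_apply_fst (S : H →L[ℂ] H) (x : WithLp 2 (H × K)) :
    oplusZero K S x = WithLp.toLp 2 (S x.fst, 0) := rfl

theorem isCompactOperator_oplusZero {S : H →L[ℂ] H} (hS : IsCompactOperator S) :
    IsCompactOperator (oplusZero K S) :=
  (hS.comp_clm (WithLp.fstL 2 ℂ H K)).clm_comp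
    (((WithLp.prodContinuousLinearEquiv 2 ℂ H K).symm : H × K →L[ℂ] WithLp 2 (H × K)) ∘L
      ContinuousLinearMap.inl ℂ H K)

theorem oplusZero_mul (S T : H →L[ℂ] H) :
    oplusZero K S * oplusZero K T = oplusZero K (S * T) := by
  ext x
  rfl

theorem Commute.oplusZero {S T : H →L[ℂ] H} (h : Commute S T) :
    Commute (oplusZero K S) (oplusZero K T) := by
  rw [Commute, SemiconjBy, oplusZero_mul, oplusZero_mul, h.eq]

theorem star_oplusZero [CompleteSpace H] [CompleteSpace K] (S : H →L[ℂ] H) :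
    star (oplusZero K S) = oplusZero K (star S) := by
  rw [ContinuousLinearMap.star_eq_adjoint, ContinuousLinearMap.star_eq_adjoint, eq_comm,
    ContinuousLinearMap.eq_adjoint_iff]
  intro x y
  rw [oplusZero_apply_fst, oplusZero_apply_fst, WithLp.prod_inner_apply, WithLp.prod_inner_apply]
  simp [ContinuousLinearMap.adjoint_inner_left]

theorem IsStarNormal.oplusZero [CompleteSpace H] [CompleteSpace K] {S : H →L[ℂ] H}
    (h : IsStarNormal S) : IsStarNormal (oplusZero K S) :=
  ⟨by rw [star_oplusZero]; exact h.star_comm_self.oplusZero⟩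

/-- Take `(0, z)` with `z` a unit vector of `K` orthogonal to the finite-dimensional projection of
`M` to `K`. -/
theorem exists_orthogonal_oplusZero_eq_zero (hK : ¬ FiniteDimensional ℂ K) {m : ℕ}
    (A : Fin m → H →L[ℂ] H) (M : Submodule ℂ (WithLp 2 (H × K))) (hM : FiniteDimensional ℂ M) :
    ∃ z ∈ Mᗮ, ‖z‖ = 1 ∧ ∀ j, oplusZero K (A j) z = 0 := by
  obtain ⟨z, hz, hzM⟩ := exists_orthonormal_orthogonal hK
    (M.map (WithLp.sndL 2 ℂ H K).toLinearMap) 1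
  refine ⟨WithLp.toLp 2 (0, z 0), fun u hu => ?_, ?_, fun j => ?_⟩
  · rw [WithLp.prod_inner_apply]
    simpa using hzM 0 u.snd ⟨u, hu, rfl⟩
  · simp [hz.1 0]
  · rw [oplusZero_apply]
    simp

end DirectSum

/-! ### The main theorem. -/

theorem theorem7p3
    {H : Type*} [NormedAddCommGroup H] [InnerProductSpace ℂ H] [CompleteSpace H]
    (hH : ¬ FiniteDimensional ℂ H)
    {K : Type*} [NormedAddCommGroup K] [InnerProductSpace ℂ K] [CompleteSpace K]
    (hK : ¬ FiniteDimensional ℂ K)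
    {m : ℕ} (A : Fin m → H →L[ℂ] H) (hA : ∀ j, IsCompactOperator (A j)) :
    (∀ k : ℕ, 1 ≤ k →
      closure (jointNumericalRange k A)
          = jointNumericalRange k (fun j => oplusZero (EuclideanSpace ℂ (Fin k)) (A j)) ∧
      jointNumericalRange k (fun j => oplusZero (EuclideanSpace ℂ (Fin k)) (A j))
          = jointNumericalRange k (fun j => oplusZero K (A j))) ∧
    (∀ k : ℕ, 1 ≤ k →
      closure (convexHull ℝ (jointNumericalRange k A))
          = convexHull ℝ
              (jointNumericalRange k (fun j => oplusZero (EuclideanSpace ℂ (Fin k)) (A j))) ∧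
      convexHull ℝ (jointNumericalRange k (fun j => oplusZero (EuclideanSpace ℂ (Fin k)) (A j)))
          = convexHull ℝ (jointNumericalRange k (fun j => oplusZero K (A j)))) ∧
    List.TFAE [
      ∀ k : ℕ, 1 ≤ k → IsPolyhedral (closure (jointNumericalRange k A)),
      ∀ k : ℕ, 1 ≤ k → IsPolyhedral (closure (convexHull ℝ (jointNumericalRange k A))),
      ((∀ j, IsStarNormal (A j)) ∧ (∀ i j, Commute (A i) (A j))) ∧
        ∀ k : ℕ, 1 ≤ k →
          IsPolyhedral (convexHull ℝ (jointEigenvalueSums k (fun j => oplusZero K (A j))))] := by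
  have hcl : ∀ k, closure (jointNumericalRange k A) = contractiveRange k A := fun k =>
    closure_jointNumericalRange hH hA
  have hfin : ∀ k, jointNumericalRange k (fun j => oplusZero (EuclideanSpace ℂ (Fin k)) (A j)) =
      contractiveRange k A := fun k =>
    jointNumericalRange_oplusZero A (EuclideanSpace.basisFun (Fin k) ℂ).orthonormal
  have hinf : ∀ k, jointNumericalRange k (fun j => oplusZero K (A j)) = contractiveRange k A :=
    fun k => by
      obtain ⟨z, hz, -⟩ := exists_orthonormal_orthogonal hK ⊥ k
      exact jointNumericalRange_oplusZero A hz
  have hconv : ∀ k, closure (convexHull ℝ (jointNumericalRange k A)) =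
      convexHull ℝ (contractiveRange k A) := fun k => by
    rw [← hcl, closure_convexHull_of_isCompact_closure]
    rw [hcl]
    exact isCompact_contractiveRange hA
  have hB : ∀ j, IsCompactOperator (oplusZero K (A j)) := fun j =>
    isCompactOperator_oplusZero (hA j)
  have hmax : (∀ j, IsStarNormal (A j)) → (∀ i j, Commute (A i) (A j)) → ∀ k,
      ∀ f : (Fin m → ℂ) →L[ℝ] ℝ, ∃ s ∈ jointEigenvalueSums k (fun j => oplusZero K (A j)),
        ∀ w ∈ contractiveRange k A, f w ≤ f s := fun hN hcomm k f => by
    rw [← hinf k]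
    exact exists_jointEigenvalueSums_max hB (fun j => (hN j).oplusZero)
      (fun i j => (hcomm i j).oplusZero) (exists_orthogonal_oplusZero_eq_zero hK A) f k
  have hsub : (∀ j, IsStarNormal (A j)) → ∀ k,
      convexHull ℝ (jointEigenvalueSums k (fun j => oplusZero K (A j))) ⊆ contractiveRange k A :=
    fun hN k => by
      rw [← hinf k]
      exact convexHull_jointEigenvalueSums_subset fun j => (hN j).oplusZero
  refine ⟨fun k _ => ⟨(hcl k).trans (hfin k).symm, (hfin k).trans (hinf k).symm⟩,
    fun k _ => ⟨by rw [hfin, hconv], by rw [hfin, hinf]⟩, ?_⟩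
  tfae_have 1 → 2 := fun h k hk => by
    obtain ⟨F, hF, hWF⟩ := h k hk
    refine ⟨F, hF, ?_⟩
    rw [hconv, ← hcl, hWF, (convex_convexHull ℝ F).convexHull_eq]
  -- Every vertex of the polytope `conv (contractiveRange k A)` is exposed, hence lies in `Σ_k`, so
  -- the two hulls agree.
  tfae_have 2 → 3 := fun h => by
    obtain ⟨hN, hcomm⟩ := isStarNormal_and_commute_of_polyhedral hA h
    refine ⟨⟨hN, hcomm⟩, fun k hk => ?_⟩
    obtain ⟨F, hF, hWF⟩ := h k hk
    rw [hconv] at hWF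
    exact ⟨F, hF, (convexHull_eq_of_forall_exists_max
      ((subset_convexHull ℝ _).trans (hsub hN k)) (hmax hN hcomm k) hF hWF).trans hWF⟩
  -- Sandwich: `conv Σ_k` lies in the range by Schur–Horn, and being closed it contains the range by
  -- separation.
  tfae_have 3 → 1 := fun ⟨⟨hN, hcomm⟩, h⟩ k hk => by
    obtain ⟨F, hF, hSF⟩ := h k hk
    refine ⟨F, hF, ?_⟩
    rw [hcl, ← hSF]
    refine (subset_convexHull_of_forall_exists_max ?_ (hmax hN hcomm k)).antisymm (hsub hN k)
    rw [hSF]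
    exact hF.isClosed_convexHull ℝ
  tfae_finish
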